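/- **Theorem (Approximate Kernel PCR).** There is a universal constant $C>0$ such that the following holds. *Data.* Let $A\in\mathbb{R}^{n\times d}$ have rows $a_1,\dots,a_n$, let $q\ge 0$ be an integer, and consider the homogeneous polynomial kernel $\mathcal K(x,z)=(x^{T}z)^q$ with feature map $\phi:\mathbb{R}^d\to\mathbb{R}^{d^q}$, $\phi(z)=(z_{i_1}z_{i_2}\cdots z_{i_q})_{i_1,\dots,i_q\in\{1,\dots,d\}}$. Let $\Phi\in\mathbb{R}^{n\times d^q}$ be the matrix with rows $\phi(a_1)^T,\dots,\phi(a_n)^T$, and let $K\in\mathbb{R}^{n\times n}$, $K_{ij}=(a_i^Ta_j)^q$, be the kernel matrix, with eigenvalues $\lambda_1\ge\dots\ge\lambda_n$; put $\lambda_{n+1}:=0$. Let $1\le k\le n$ with $\lambda_k>\lambda_{k+1}$. *Sketch.* Let $h_1,\dots,h_q:\{1,\dots,d\}\to\mathbb{Z}/t$ be $3$-wise independent random hash functions and $g_1,\dots,g_q:\{1,\dots,d\}\to\{-1,+1\}$ be $4$-wise independent random sign functions, all $2q$ of them mutually independent (an $r$-wise independent random function takes independent, uniformly distributed values at any at most $r$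 distinct arguments). The TensorSketch matrix $R\in\mathbb{R}^{d^q\times t}$ has as its row with index $(i_1,\dots,i_q)$ the vector $g_1(i_1)\cdots g_q(i_q)\,e_{H}$ with $H=h_1(i_1)+\dots+h_q(i_q) \bmod t$, where $e_j$ is the $j$-th unit vector. *Estimators.* For a matrix $X$ with thin singular value decomposition $X=U_X\Sigma_XV_X^T$ (nonnegative singular values in decreasing order), $V_{X,k}$ denotes the matrix of the first $k$ columns of $V_X$, and $X^+$ the Moore–Penrose pseudo-inverse. For a response $b\in\mathbb{R}^n$ the kernel PCR estimator is $$x_{\mathcal K,k}:=\arg\min_{x\in\operatorname{range}(V_{\Phi,k})}\|\Phi x-b\|_2,$$ and the sketched kernel PCR estimator is $$x_{\mathcal K,R,k}:=R\,V_{\Phi R,k}\,(\Phi R\,V_{\Phi R,k})^{+}\,b .$$ *Statistical model and risk.* The response is $b=f+\xi$, where $f\in\mathbb{R}^n$ is fixed and $\xi_1,\dots,\xi_n$ are independent random variables with mean $0$ and variance $\sigma^2$. Let $x^\star$ be the minimizer of $\mathbb{E}_\xi\|\Phi x-b\|_2^2/n$ over $x\in\mathbb{R}^{d^q}$ (the one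 of minimum norm if there are several). The excess risk of an estimator $\theta=\theta(b)$ is $\mathcal E(\theta):=\mathbb{E}_\xi\|\Phi\theta-\Phi x^\star\|_2^2/n$; the expectation is over the noise only, for a fixed sketching matrix. *Claim.* For all $\nu,\delta\in(0,1/2)$, if $$t\;\ge\; C\,\frac{3^q\,\mathrm{Tr}(K)^2}{(\lambda_k-\lambda_{k+1})^2\,\nu^2\,\delta},$$ then, with probability at least $1-\delta$ over the choice of $R$, $$\mathcal E(x_{\mathcal K,R,k})\le\mathcal E(x_{\mathcal K,k})+\frac{(2\nu+\nu^2)\,\|f\|_2^2}{n},$$ for every choice of the thin singular value decompositions of $\Phi$ and $\Phi R$. -/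

import Mathlib

open Matrix MeasureTheory ProbabilityTheory
open scoped ENNReal

/-! ### Linear algebra -/

section LinearAlgebra

/-- The Euclidean norm of a finite real vector. -/
noncomputable def euclNorm {m : Type*} [Fintype m] (v : m → ℝ) : ℝ :=
  ‖(WithLp.toLp 2 v : EuclideanSpace ℝ m)‖

/-- A thin singular value decomposition `X = U * diag(σ) * Vᵀ`: `U` and `V` have `min(m, p)`
orthonormal columns and the singular values `σ` are nonnegative and listed in decreasing order. -/
structure ThinSVD {m p : Type*} [Fintype m] [Fintype p] (X : Matrix m p ℝ) where
  U : Matrix m (Fin (min (Fintype.card m) (Fintype.card p))) ℝ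
  σ : Fin (min (Fintype.card m) (Fintype.card p)) → ℝ
  V : Matrix p (Fin (min (Fintype.card m) (Fintype.card p))) ℝ
  U_orthonormal : Uᵀ * U = 1
  V_orthonormal : Vᵀ * V = 1
  σ_nonneg : ∀ i, 0 ≤ σ i
  σ_antitone : Antitone σ
  eq_mul : X = U * Matrix.diagonal σ * Vᵀ

/-- The matrix `V_{X,k}` of the first `k` columns of the right singular factor `V_X`. -/
def ThinSVD.leadingV {m p : Type*} [Fintype m] [Fintype p] {X : Matrix m p ℝ} (S : ThinSVD X)
    (k : ℕ) :
    Matrix p {j : Fin (min (Fintype.card m) (Fintype.card p)) // (j : ℕ) < k} ℝ :=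
  S.V.submatrix id Subtype.val

/-- `Y` is the Moore-Penrose pseudo-inverse of `X` (the four Penrose equations). -/
structure IsMoorePenrose {m p : Type*} [Fintype m] [Fintype p]
    (X : Matrix m p ℝ) (Y : Matrix p m ℝ) : Prop where
  mul_left : X * Y * X = X
  mul_right : Y * X * Y = Y
  symm_left : (X * Y)ᵀ = X * Y
  symm_right : (Y * X)ᵀ = Y * X

theorem IsMoorePenrose.unique {m p : Type*} [Fintype m] [Fintype p]
    {X : Matrix m p ℝ} {Y Z : Matrix p m ℝ} (hY : IsMoorePenrose X Y) (hZ : IsMoorePenrose X Z) :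
    Y = Z := by
  have h1 : X * Y = X * Z := by
    calc X * Y = (X * Y)ᵀ := hY.symm_left.symm
      _ = ((X * Z) * (X * Y))ᵀ := by rw [← Matrix.mul_assoc, hZ.mul_left]
      _ = (X * Y) * (X * Z) := by rw [Matrix.transpose_mul, hY.symm_left, hZ.symm_left]
      _ = X * Z := by rw [← Matrix.mul_assoc, hY.mul_left]
  have h2 : Y * X = Z * X := by
    calc Y * X = (Y * X)ᵀ := hY.symm_right.symm
      _ = ((Y * X) * (Z * X))ᵀ := by
          rw [Matrix.mul_assoc Y X (Z * X), ← Matrix.mul_assoc X Z X, hZ.mul_left]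
      _ = (Z * X) * (Y * X) := by rw [Matrix.transpose_mul, hY.symm_right, hZ.symm_right]
      _ = Z * X := by rw [Matrix.mul_assoc Z X (Y * X), ← Matrix.mul_assoc X Y X, hY.mul_left]
  calc Y = Y * X * Y := hY.mul_right.symm
    _ = Z * X * Y := by rw [h2]
    _ = Z * (X * Y) := Matrix.mul_assoc _ _ _
    _ = Z * (X * Z) := by rw [h1]
    _ = Z := by rw [← Matrix.mul_assoc, hZ.mul_right]

theorem exists_isMoorePenrose {m p : Type*} [Fintype m] [Fintype p] (X : Matrix m p ℝ) :
    ∃ Y : Matrix p m ℝ, IsMoorePenrose X Y := by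
  classical
  have hH : (Xᵀ * X).IsHermitian := by
    simpa [conjTranspose_eq_transpose_of_trivial] using isHermitian_conjTranspose_mul_self X
  -- a symmetric pseudo-inverse of the Gram matrix, from its spectral decomposition
  obtain ⟨G, hG1, hG2, hG3, hG4⟩ : ∃ G : Matrix p p ℝ, Xᵀ * X * G * (Xᵀ * X) = Xᵀ * X ∧
      G * (Xᵀ * X) * G = G ∧ Gᵀ = G ∧ (G * (Xᵀ * X))ᵀ = G * (Xᵀ * X) := by
    obtain ⟨W, e, hWW, hS⟩ : ∃ (W : Matrix p p ℝ) (e : p → ℝ), Wᵀ * W = 1 ∧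
        Xᵀ * X = W * diagonal e * Wᵀ := by
      refine ⟨hH.eigenvectorUnitary, hH.eigenvalues, ?_, ?_⟩
      · have := Unitary.coe_star_mul_self hH.eigenvectorUnitary
        simpa [star_eq_conjTranspose, conjTranspose_eq_transpose_of_trivial] using this
      · refine hH.spectral_theorem.trans ?_
        simp [Unitary.conjStarAlgAut_apply, star_eq_conjTranspose,
          conjTranspose_eq_transpose_of_trivial]
    have key : ∀ a b : p → ℝ, (W * diagonal a * Wᵀ) * (W * diagonal b * Wᵀ)
        = W * diagonal (fun i => a i * b i) * Wᵀ := by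
      intro a b
      calc (W * diagonal a * Wᵀ) * (W * diagonal b * Wᵀ)
          = W * diagonal a * (Wᵀ * W) * diagonal b * Wᵀ := by simp only [Matrix.mul_assoc]
        _ = _ := by rw [hWW, Matrix.mul_one, Matrix.mul_assoc W, diagonal_mul_diagonal]
    have keyT : ∀ a : p → ℝ, (W * diagonal a * Wᵀ)ᵀ = W * diagonal a * Wᵀ := by
      intro a
      simp [Matrix.transpose_mul, Matrix.mul_assoc]
    refine ⟨W * diagonal (fun i => (e i)⁻¹) * Wᵀ, ?_, ?_, keyT _, ?_⟩
    · rw [hS, key, key]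
      simp only [mul_inv_mul_cancel]
    · rw [hS, key, key]
      congr 3
      funext i
      by_cases h : e i = 0
      · simp [h]
      · field_simp
    · rw [hS, key, keyT]
  have hX : X * (G * (Xᵀ * X)) = X := by
    have h0 : (X * (G * (Xᵀ * X)) - X)ᴴ * (X * (G * (Xᵀ * X)) - X) = 0 := by
      rw [conjTranspose_eq_transpose_of_trivial]
      have e : (X * (G * (Xᵀ * X)) - X)ᵀ * (X * (G * (Xᵀ * X)) - X)
          = (G * (Xᵀ * X) - 1)ᵀ * (Xᵀ * X * G * (Xᵀ * X) - Xᵀ * X) := by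
        have : X * (G * (Xᵀ * X)) - X = X * (G * (Xᵀ * X) - 1) := by
          rw [Matrix.mul_sub, Matrix.mul_one]
        rw [this, Matrix.transpose_mul, Matrix.mul_assoc, ← Matrix.mul_assoc Xᵀ X,
          Matrix.mul_sub (Xᵀ * X), Matrix.mul_one, ← Matrix.mul_assoc (Xᵀ * X) G]
      rw [e, hG1, sub_self, Matrix.mul_zero]
    exact sub_eq_zero.mp (conjTranspose_mul_self_eq_zero.mp h0)
  refine ⟨G * Xᵀ, ?_, ?_, ?_, ?_⟩
  · simpa only [Matrix.mul_assoc] using hX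
  · calc G * Xᵀ * X * (G * Xᵀ) = (G * (Xᵀ * X) * G) * Xᵀ := by simp only [Matrix.mul_assoc]
      _ = G * Xᵀ := by rw [hG2]
  · simp [Matrix.transpose_mul, Matrix.mul_assoc, hG3]
  · rw [Matrix.mul_assoc G]
    exact hG4

/-- The Moore-Penrose pseudo-inverse `X⁺`. -/
noncomputable def pinv {m p : Type*} [Fintype m] [Fintype p] (X : Matrix m p ℝ) : Matrix p m ℝ :=
  (exists_isMoorePenrose X).choose

theorem pinv_spec {m p : Type*} [Fintype m] [Fintype p] (X : Matrix m p ℝ) :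
    IsMoorePenrose X (pinv X) :=
  (exists_isMoorePenrose X).choose_spec

/-- The pseudo-inverse is `V * diag(σ⁺) * Uᵀ` for every thin singular value decomposition, where
`a⁺ = a⁻¹` if `a ≠ 0` and `0⁺ = 0`. -/
theorem ThinSVD.pinv_eq {m p : Type*} [Fintype m] [Fintype p] {X : Matrix m p ℝ}
    (S : ThinSVD X) : pinv X = S.V * diagonal (fun i => (S.σ i)⁻¹) * S.Uᵀ := by
  have h1 : X * (S.V * diagonal (fun i => (S.σ i)⁻¹) * S.Uᵀ)
      = S.U * diagonal (fun i => S.σ i * (S.σ i)⁻¹) * S.Uᵀ := by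
    calc X * (S.V * diagonal (fun i => (S.σ i)⁻¹) * S.Uᵀ)
        = S.U * diagonal S.σ * S.Vᵀ * (S.V * diagonal (fun i => (S.σ i)⁻¹) * S.Uᵀ) := by
          rw [← S.eq_mul]
      _ = S.U * diagonal S.σ * (S.Vᵀ * S.V) * diagonal (fun i => (S.σ i)⁻¹) * S.Uᵀ := by
          simp only [Matrix.mul_assoc]
      _ = _ := by rw [S.V_orthonormal, Matrix.mul_one, Matrix.mul_assoc S.U,
            diagonal_mul_diagonal]
  have h2 : (S.V * diagonal (fun i => (S.σ i)⁻¹) * S.Uᵀ) * X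
      = S.V * diagonal (fun i => (S.σ i)⁻¹ * S.σ i) * S.Vᵀ := by
    calc (S.V * diagonal (fun i => (S.σ i)⁻¹) * S.Uᵀ) * X
        = (S.V * diagonal (fun i => (S.σ i)⁻¹) * S.Uᵀ) * (S.U * diagonal S.σ * S.Vᵀ) := by
          rw [← S.eq_mul]
      _ = S.V * diagonal (fun i => (S.σ i)⁻¹) * (S.Uᵀ * S.U) * diagonal S.σ * S.Vᵀ := by
          simp only [Matrix.mul_assoc]
      _ = _ := by rw [S.U_orthonormal, Matrix.mul_one, Matrix.mul_assoc S.V,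
            diagonal_mul_diagonal]
  refine (pinv_spec X).unique ⟨?_, ?_, ?_, ?_⟩
  · rw [h1]
    calc S.U * diagonal (fun i => S.σ i * (S.σ i)⁻¹) * S.Uᵀ * X
        = S.U * diagonal (fun i => S.σ i * (S.σ i)⁻¹) * S.Uᵀ * (S.U * diagonal S.σ * S.Vᵀ) := by
          rw [← S.eq_mul]
      _ = S.U * diagonal (fun i => S.σ i * (S.σ i)⁻¹) * (S.Uᵀ * S.U) * diagonal S.σ * S.Vᵀ := by
          simp only [Matrix.mul_assoc]
      _ = X := by
          rw [S.U_orthonormal, Matrix.mul_one, Matrix.mul_assoc S.U, diagonal_mul_diagonal]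
          simp only [mul_inv_mul_cancel]
          exact S.eq_mul.symm
  · rw [h2]
    calc S.V * diagonal (fun i => (S.σ i)⁻¹ * S.σ i) * S.Vᵀ
          * (S.V * diagonal (fun i => (S.σ i)⁻¹) * S.Uᵀ)
        = S.V * diagonal (fun i => (S.σ i)⁻¹ * S.σ i) * (S.Vᵀ * S.V)
          * diagonal (fun i => (S.σ i)⁻¹) * S.Uᵀ := by
          simp only [Matrix.mul_assoc]
      _ = _ := by
          rw [S.V_orthonormal, Matrix.mul_one, Matrix.mul_assoc S.V, diagonal_mul_diagonal]
          congr 3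
          funext i
          by_cases h : S.σ i = 0
          · simp [h]
          · field_simp
  · rw [h1]
    simp [Matrix.transpose_mul, Matrix.mul_assoc]
  · rw [h2]
    simp [Matrix.transpose_mul, Matrix.mul_assoc]

end LinearAlgebra

/-! ### The polynomial kernel -/

section Kernel

/-- The feature map `φ : ℝ^d → ℝ^(d^q)`, `φ(z)_(i₁,…,i_q) = z_(i₁) ⋯ z_(i_q)`. -/
def polyFeature {d : ℕ} (q : ℕ) (z : Fin d → ℝ) : (Fin q → Fin d) → ℝ :=
  fun i => ∏ c, z (i c)

/-- The matrix `Φ`: the feature map applied to the rows of the data matrix `A`. -/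
def featureMatrix {n d : ℕ} (A : Matrix (Fin n) (Fin d) ℝ) (q : ℕ) :
    Matrix (Fin n) (Fin q → Fin d) ℝ :=
  Matrix.of fun i => polyFeature q (A i)

/-- The kernel matrix `K_ij = (a_iᵀ a_j)^q`, where `a_i` are the rows of `A`. -/
def kernelMatrix {n d : ℕ} (A : Matrix (Fin n) (Fin d) ℝ) (q : ℕ) : Matrix (Fin n) (Fin n) ℝ :=
  Matrix.of fun i j => (A i ⬝ᵥ A j) ^ q

theorem kernelMatrix_isHermitian {n d : ℕ} (A : Matrix (Fin n) (Fin d) ℝ) (q : ℕ) :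
    (kernelMatrix A q).IsHermitian := by
  ext i j
  simp [kernelMatrix, dotProduct_comm]

/-- The `j`-th largest eigenvalue `λ_j` (with multiplicity) of the `n × n` kernel matrix, for
`1 ≤ j ≤ n`; the value is `0` for other `j`. -/
noncomputable def kernelEigenvalue {n d : ℕ} (A : Matrix (Fin n) (Fin d) ℝ) (q j : ℕ) : ℝ :=
  if h : 1 ≤ j ∧ j ≤ n then
    (kernelMatrix_isHermitian A q).eigenvalues₀
      ⟨j - 1, by rw [Fintype.card_fin]; exact (Nat.sub_one_lt_of_le h.1 h.2)⟩
  else 0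

end Kernel

/-! ### TensorSketch -/

section TensorSketch

/-- The `β`-valued family `X` is `r`-wise independent (with uniformly distributed values): the
values at any at most `r` distinct indices are independent and uniform on `β`. -/
def IsKWiseIndependent {ι β Ω : Type*} [Fintype β] [MeasurableSpace Ω] (P : Measure Ω) (r : ℕ)
    (X : ι → Ω → β) : Prop :=
  ∀ s : Finset ι, s.card ≤ r → ∀ y : ι → β,
    P {ω | ∀ i ∈ s, X i ω = y i} = ((Fintype.card β : ℝ≥0∞)⁻¹) ^ s.card

/-- The random functions `h₁, …, h_q : {1,…,d} → ℤ/t` and `g₁, …, g_q : {1,…,d} → {-1,+1}` used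
by TensorSketch: each `h_c` is 3-wise independent, each `g_c` is 4-wise independent, and these
`2q` random functions are mutually independent. -/
structure IsTensorSketchHashing {q d t : ℕ} [NeZero t] {Ω : Type*} [MeasurableSpace Ω]
    (P : Measure Ω) (h : Fin q → Fin d → Ω → ZMod t) (g : Fin q → Fin d → Ω → ℤˣ) : Prop where
  measurable_h : ∀ c i, Measurable (h c i)
  measurable_g : ∀ c i, Measurable (g c i)
  hash : ∀ c, IsKWiseIndependent P 3 (h c)
  sign : ∀ c, IsKWiseIndependent P 4 (g c)
  indep_h : iIndepFun (fun c ω i => h c i ω) P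
  indep_g : iIndepFun (fun c ω i => g c i ω) P
  indep_h_g : IndepFun (fun ω c i => h c i ω) (fun ω c i => g c i ω) P

/-- The TensorSketch matrix of given functions `h_c`, `g_c`: its row `(i₁,…,i_q)` is
`g₁(i₁) ⋯ g_q(i_q)` times the unit vector with index `h₁(i₁) + ⋯ + h_q(i_q) mod t`. -/
def tensorSketch {q d t : ℕ} (h : Fin q → Fin d → ZMod t) (g : Fin q → Fin d → ℤˣ) :
    Matrix (Fin q → Fin d) (ZMod t) ℝ :=
  Matrix.of fun i j => if j = ∑ c, h c (i c) then ∏ c, (((g c (i c) : ℤˣ) : ℤ) : ℝ) else 0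

end TensorSketch

/-! ### Principal component regression and excess risk -/

section PCR

/-- `x` is the rank-`k` PCR solution for `X`, `b`: it minimizes `‖X x - b‖` over the range of
`V_{X,k}`. -/
def IsPCRSolution {m p : Type*} [Fintype m] [Fintype p] {X : Matrix m p ℝ} (S : ThinSVD X) (k : ℕ)
    (b : m → ℝ) (x : p → ℝ) : Prop :=
  x ∈ Set.range (S.leadingV k *ᵥ ·) ∧
    ∀ y ∈ Set.range (S.leadingV k *ᵥ ·), euclNorm (X *ᵥ x - b) ≤ euclNorm (X *ᵥ y - b)

/-- The right-sketched PCR solution `R V_{XR,k} (X R V_{XR,k})⁺ b`. -/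
noncomputable def sketchedPCR {m p s : Type*} [Fintype m] [Fintype p] [Fintype s]
    (X : Matrix m p ℝ) (R : Matrix p s ℝ) (T : ThinSVD (X * R)) (k : ℕ) (b : m → ℝ) : p → ℝ :=
  (R * T.leadingV k * pinv (X * R * T.leadingV k)) *ᵥ b

/-- `xstar` is the minimizer of `𝔼 ‖X x - b‖² / n` over all `x`, of minimum norm if there are
several; `n` is the number of rows of `X`, and `b` is a random vector. -/
def IsOptimalPredictor {n : ℕ} {p Ω : Type*} [Fintype p] [MeasurableSpace Ω] (μ : Measure Ω)
    (X : Matrix (Fin n) p ℝ) (b : Ω → Fin n → ℝ) (xstar : p → ℝ) : Prop :=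
  (∀ y, ∫ ω, euclNorm (X *ᵥ xstar - b ω) ^ 2 / n ∂μ ≤ ∫ ω, euclNorm (X *ᵥ y - b ω) ^ 2 / n ∂μ) ∧
    ∀ x, (∀ y, ∫ ω, euclNorm (X *ᵥ x - b ω) ^ 2 / n ∂μ ≤
        ∫ ω, euclNorm (X *ᵥ y - b ω) ^ 2 / n ∂μ) → euclNorm xstar ≤ euclNorm x

/-- The excess risk `𝔼 ‖X θ - X xstar‖² / n` of an estimator `θ` of `xstar`. -/
noncomputable def excessRisk {n : ℕ} {p Ω : Type*} [Fintype p] [MeasurableSpace Ω] (μ : Measure Ω)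
    (X : Matrix (Fin n) p ℝ) (xstar : p → ℝ) (θ : Ω → p → ℝ) : ℝ :=
  ∫ ω, euclNorm (X *ᵥ θ ω - X *ᵥ xstar) ^ 2 / n ∂μ

/-- The fixed-design noise model `b_i = f_i + ξ_i`: the `ξ_i` are independent with mean zero and
variance `σ²`. -/
structure IsFixedDesignResponse {n : ℕ} {Ω : Type*} [MeasurableSpace Ω] (μ : Measure Ω)
    (f : Fin n → ℝ) (σ : ℝ) (ξ : Fin n → Ω → ℝ) (b : Ω → Fin n → ℝ) : Prop where
  memLp : ∀ i, MemLp (ξ i) 2 μ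
  indep : iIndepFun ξ μ
  mean : ∀ i, ∫ ω, ξ i ω ∂μ = 0
  variance : ∀ i, variance (ξ i) μ = σ ^ 2
  response : ∀ ω i, b ω i = f i + ξ i ω

end PCR

/-! Write Φ for `featureMatrix A q`, R for the sketch, K = ΦΦᵀ, K' = ΦR(ΦR)ᵀ and Δ = λ_k − λ_{k+1}.

Reduction to projections. The estimators enter the risk only through their fitted values Q₁b and
Q₂b, where Q₁, Q₂ are the orthogonal projections onto the ranges of ΦV_{Φ,k} and ΦRV_{ΦR,k}; the
optimal predictor has fitted values Ef with E = ΦΦ⁺. A projection Q has risk (‖Qf − Ef‖² +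
σ²‖Q‖_F²)/n. The gap forces tr Q₁ = k ≥ tr Q₂, so sketching does not increase the variance. If ‖Q₁ −
Q₂‖_F ≤ ν, the bias norm grows by at most ν‖f‖, and since the exact bias is at most ‖f‖, squaring
produces 2ν + ν² (`projection_risk_le`).

Perturbation (`frobSq_spectralProj_sub_le`). Among projections Q of rank at most k, Q₁ maximizes
tr(KQ), and the deficit of any other Q is at least Δ‖Q₁ − Q‖_F²/2. By Ky Fan, Q₂ maximizes tr(K'Q).
Comparing the two optimality properties gives Δ‖Q₁ − Q₂‖_F²/2 ≤ tr((K' − K)(Q₂ − Q₁)), and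
Cauchy–Schwarz yields ‖Q₁ − Q₂‖_F ≤ 2‖K' − K‖_F/Δ.

Sketching error (`IsTensorSketchHashing.integral_sketchInner_sub_sq_le`). By Fourier analysis on
ℤ/t, a sketched inner product is the average over t frequencies w of variables Z_w, each a product
of q independent factors with mean aᵀb. Z_w and Z_{w'} are uncorrelated unless w' = ±w, so at most
2t of the t² covariances survive; the three pairings of four signs bound each by a multiple of 3^q.
Summing over entries, E‖K' − K‖_F² ≤ 4·3^q Tr(K)²/t, and Markov's inequality finishes the proof. -/

/-! ### Frobenius norms and perturbation of spectral projections -/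

section Perturbation

/-- The squared Frobenius norm. -/
def frobSq {m p : Type*} [Fintype m] [Fintype p] (M : Matrix m p ℝ) : ℝ := ∑ i, ∑ j, M i j ^ 2

variable {m p : Type*} [Fintype m] [Fintype p]

theorem frobSq_nonneg (M : Matrix m p ℝ) : 0 ≤ frobSq M :=
  Finset.sum_nonneg fun _ _ => Finset.sum_nonneg fun _ _ => sq_nonneg _

theorem trace_transpose_mul_self (M : Matrix m p ℝ) : (Mᵀ * M).trace = frobSq M := by
  rw [frobSq, Finset.sum_comm]
  simp [trace, Matrix.mul_apply, sq]

theorem frobSq_eq_zero {M : Matrix m p ℝ} (h : frobSq M ≤ 0) : M = 0 := by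
  ext i j
  have h1 : ∑ j, M i j ^ 2 ≤ frobSq M :=
    Finset.single_le_sum (f := fun i => ∑ j, M i j ^ 2)
      (fun _ _ => Finset.sum_nonneg fun _ _ => sq_nonneg _) (Finset.mem_univ i)
  have h2 : M i j ^ 2 ≤ ∑ j, M i j ^ 2 :=
    Finset.single_le_sum (f := fun j => M i j ^ 2) (fun _ _ => sq_nonneg _) (Finset.mem_univ j)
  have h3 : M i j ^ 2 ≤ 0 := by linarith
  simpa using h3

theorem trace_mul_sq_le (A : Matrix m p ℝ) (B : Matrix p m ℝ) :
    (A * B).trace ^ 2 ≤ frobSq A * frobSq B := by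
  have h := Finset.sum_mul_sq_le_sq_mul_sq (Finset.univ : Finset (m × p))
    (fun x => A x.1 x.2) (fun x => B x.2 x.1)
  simp only [Fintype.sum_prod_type] at h
  have h2 : frobSq B = ∑ i, ∑ j, B j i ^ 2 := by rw [frobSq, Finset.sum_comm]
  rw [h2, frobSq]
  simpa [trace, Matrix.mul_apply] using h

theorem dotProduct_sq_le (v w : m → ℝ) : (v ⬝ᵥ w) ^ 2 ≤ (v ⬝ᵥ v) * (w ⬝ᵥ w) := by
  simpa [dotProduct, sq] using Finset.sum_mul_sq_le_sq_mul_sq Finset.univ v w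

theorem mulVec_dotProduct_self_le (M : Matrix m p ℝ) (v : p → ℝ) :
    (M *ᵥ v) ⬝ᵥ (M *ᵥ v) ≤ frobSq M * (v ⬝ᵥ v) := by
  rw [frobSq, Finset.sum_mul]
  refine Finset.sum_le_sum fun i _ => ?_
  have := dotProduct_sq_le (M i) v
  simpa [mulVec, dotProduct, sq] using this

theorem frobSq_neg (M : Matrix m p ℝ) : frobSq (-M) = frobSq M := by
  simp [frobSq]

/-- An orthogonal projection matrix. -/
structure IsOrthProj (Q : Matrix m m ℝ) : Prop where
  symm : Qᵀ = Q
  idem : Q * Q = Q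

namespace IsOrthProj

variable {Q P : Matrix m m ℝ}

theorem frobSq_eq (hQ : IsOrthProj Q) : frobSq Q = Q.trace := by
  rw [← trace_transpose_mul_self, hQ.symm, hQ.idem]

theorem frobSq_sub (hP : IsOrthProj P) (hQ : IsOrthProj Q) :
    frobSq (P - Q) = P.trace + Q.trace - 2 * (P * Q).trace := by
  rw [← trace_transpose_mul_self, transpose_sub, hP.symm, hQ.symm, Matrix.sub_mul,
    Matrix.mul_sub, Matrix.mul_sub, hP.idem, hQ.idem, trace_sub, trace_sub, trace_sub,
    trace_mul_comm Q P]
  ring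

theorem sub_one [DecidableEq m] (hQ : IsOrthProj Q) : IsOrthProj (1 - Q) := by
  refine ⟨by simp [hQ.symm], ?_⟩
  rw [Matrix.sub_mul, Matrix.mul_sub, Matrix.mul_sub, hQ.idem]
  simp

/-- The quadratic form of an orthogonal projection on an orthonormal family lies in `[0, 1]`. -/
theorem diag_conj_mem {r : Type*} [DecidableEq r] (hQ : IsOrthProj Q) {U : Matrix m r ℝ}
    (hU : Uᵀ * U = 1) (i : r) : 0 ≤ (Uᵀ * Q * U) i i ∧ (Uᵀ * Q * U) i i ≤ 1 := by
  classical
  have key : ∀ Q : Matrix m m ℝ, IsOrthProj Q → 0 ≤ (Uᵀ * Q * U) i i := by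
    intro Q hQ
    have : Uᵀ * Q * U = (Q * U)ᵀ * (Q * U) := by
      rw [transpose_mul, hQ.symm, Matrix.mul_assoc, Matrix.mul_assoc, ← Matrix.mul_assoc Q Q,
        hQ.idem]
    rw [this, Matrix.mul_apply]
    exact Finset.sum_nonneg fun _ _ => mul_self_nonneg _
  refine ⟨key Q hQ, ?_⟩
  have h := key _ hQ.sub_one
  rw [Matrix.mul_sub, Matrix.sub_mul, Matrix.mul_one, hU] at h
  simpa using h

end IsOrthProj

theorem isOrthProj_mul_transpose [DecidableEq p] {U : Matrix m p ℝ} (hU : Uᵀ * U = 1) :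
    IsOrthProj (U * Uᵀ) := by
  refine ⟨by simp, ?_⟩
  rw [Matrix.mul_assoc, ← Matrix.mul_assoc Uᵀ, hU, Matrix.one_mul]

/-- Cyclicity turns the left side into tr(UUᵀP), and the defect tr((1 − UUᵀ)P) is the squared
Frobenius norm of (1 − UUᵀ)P. -/
theorem trace_conj_le [DecidableEq p] {U : Matrix m p ℝ} (hU : Uᵀ * U = 1) {P : Matrix m m ℝ}
    (hP : IsOrthProj P) : (Uᵀ * P * U).trace ≤ P.trace := by
  classical
  have h1 : (Uᵀ * P * U).trace = (U * Uᵀ * P).trace := by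
    rw [trace_mul_comm, ← Matrix.mul_assoc]
  have h2 := (isOrthProj_mul_transpose hU).sub_one
  have h3 : ((1 - U * Uᵀ) * P).trace = frobSq ((1 - U * Uᵀ) * P) := by
    rw [← trace_transpose_mul_self, transpose_mul, h2.symm, hP.symm, Matrix.mul_assoc,
      ← Matrix.mul_assoc (1 - U * Uᵀ) (1 - U * Uᵀ), h2.idem, trace_mul_comm P, Matrix.mul_assoc,
      hP.idem]
  have h4 := frobSq_nonneg ((1 - U * Uᵀ) * P)
  rw [← h3, Matrix.sub_mul, trace_sub, Matrix.one_mul] at h4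
  rw [h1]
  linarith

/-- This reduces trace comparisons to weighted sums of the diagonal entries of a projection in an
eigenbasis. -/
theorem trace_mul_diagonal_conj [DecidableEq p] (U : Matrix m p ℝ) (s : p → ℝ)
    (P : Matrix m m ℝ) :
    (U * diagonal s * Uᵀ * P).trace = ∑ i, s i * (Uᵀ * P * U) i i := by
  rw [Matrix.mul_assoc, Matrix.mul_assoc, trace_mul_comm, Matrix.mul_assoc]
  simp [trace, Matrix.diagonal_mul]

/-- The gap inequality behind the perturbation bound, in terms of the diagonal entries `x i` of a
projection in an eigenbasis. -/
theorem gap_sum_le {ι : Type*} [Fintype ι] (s : Finset ι) (lam x : ι → ℝ) {α β : ℝ} (hβ : 0 ≤ β)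
    (hα : ∀ i ∈ s, α ≤ lam i) (hβ' : ∀ i ∉ s, lam i ≤ β)
    (h0 : ∀ i, 0 ≤ x i) (h1 : ∀ i, x i ≤ 1) (hsum : ∑ i, x i ≤ s.card) :
    (α - β) * (s.card - ∑ i ∈ s, x i) ≤ ∑ i ∈ s, lam i - ∑ i, lam i * x i := by
  classical
  rw [← Finset.sum_add_sum_compl s] at hsum
  rw [← Finset.sum_add_sum_compl s (fun i => lam i * x i)]
  have a1 : ∑ i ∈ s, α * (1 - x i) ≤ ∑ i ∈ s, lam i * (1 - x i) :=
    Finset.sum_le_sum fun i hi => mul_le_mul_of_nonneg_right (hα i hi) (by linarith [h1 i])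
  have a2 : ∑ i ∈ sᶜ, lam i * x i ≤ ∑ i ∈ sᶜ, β * x i :=
    Finset.sum_le_sum fun i hi =>
      mul_le_mul_of_nonneg_right (hβ' i (Finset.mem_compl.mp hi)) (h0 i)
  rw [← Finset.mul_sum] at a1 a2
  simp only [mul_sub, mul_one, Finset.sum_sub_distrib, Finset.sum_const, nsmul_eq_mul] at a1
  -- The total mass is only bounded by |s|, not equal to it, so replacing the mass outside s by the
  -- deficit inside s needs β ≥ 0.
  have a3 : β * ∑ i ∈ sᶜ, x i ≤ β * (s.card - ∑ i ∈ s, x i) :=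
    mul_le_mul_of_nonneg_left (by linarith) hβ
  linarith

theorem isOrthProj_conj_indicator [DecidableEq p] {W : Matrix m p ℝ} (hW : Wᵀ * W = 1)
    (s : Finset p) : IsOrthProj (W * diagonal (fun i => if i ∈ s then (1 : ℝ) else 0) * Wᵀ) := by
  refine ⟨by simp [Matrix.mul_assoc], ?_⟩
  rw [← Matrix.mul_assoc, ← Matrix.mul_assoc, Matrix.mul_assoc (W * _) Wᵀ W, hW,
    Matrix.mul_one, Matrix.mul_assoc W, diagonal_mul_diagonal]
  congr 3
  funext i
  simp

/-- A sin-theta bound: `P` is the spectral projection of `K = W diag(lam) Wᵀ` onto the eigenvalues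
in `s`, which exceed the others by a gap, and `Q` is a projection of at most the same rank which
captures at least as much of `K'` as `P` does. -/
theorem frobSq_spectralProj_sub_le [DecidableEq m] {W : Matrix m m ℝ} (hW : Wᵀ * W = 1)
    (lam : m → ℝ) (s : Finset m) {α β : ℝ} (hβ : 0 ≤ β) (hαβ : β < α)
    (hα : ∀ i ∈ s, α ≤ lam i) (hβ' : ∀ i ∉ s, lam i ≤ β)
    {K K' P Q : Matrix m m ℝ} (hK : K = W * diagonal lam * Wᵀ)
    (hP : P = W * diagonal (fun i => if i ∈ s then 1 else 0) * Wᵀ)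
    (hQ : IsOrthProj Q) (hQtr : Q.trace ≤ s.card) (hPQ : (K' * P).trace ≤ (K' * Q).trace) :
    frobSq (P - Q) ≤ 4 * frobSq (K' - K) / (α - β) ^ 2 := by
  have hWW : W * Wᵀ = 1 := mul_eq_one_comm.mp hW
  have conj : ∀ a : m → ℝ, Wᵀ * (W * diagonal a * Wᵀ) * W = diagonal a := fun a => by
    rw [Matrix.mul_assoc W, ← Matrix.mul_assoc Wᵀ, hW, Matrix.one_mul, Matrix.mul_assoc, hW,
      Matrix.mul_one]
  have hPp : IsOrthProj P := hP ▸ isOrthProj_conj_indicator hW s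
  have tr : ∀ M : Matrix m m ℝ, M.trace = ∑ i, (Wᵀ * M * W) i i := fun M => by
    have : M.trace = (Wᵀ * M * W).trace := by
      rw [trace_mul_comm, ← Matrix.mul_assoc, hWW, Matrix.one_mul]
    rw [this]; rfl
  have hPtr : P.trace = s.card := by
    rw [tr, hP, conj]
    simp
  have hPQtr : (P * Q).trace = ∑ i ∈ s, (Wᵀ * Q * W) i i := by
    rw [hP, trace_mul_diagonal_conj]
    simp
  have hKP : (K * P).trace = ∑ i ∈ s, lam i := by
    rw [hK, trace_mul_diagonal_conj, hP, conj]
    simp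
  have hKQ : (K * Q).trace = ∑ i, lam i * (Wᵀ * Q * W) i i := by
    rw [hK, trace_mul_diagonal_conj]
  have hgap := gap_sum_le s lam (fun i => (Wᵀ * Q * W) i i) hβ hα hβ'
    (fun i => (hQ.diag_conj_mem hW i).1) (fun i => (hQ.diag_conj_mem hW i).2)
    (by rw [← tr]; exact hQtr)
  rw [← hPQtr, ← hKP, ← hKQ] at hgap
  have hF := hPp.frobSq_sub hQ
  have hCS := trace_mul_sq_le (K' - K) (P - Q)
  have htr : ((K' - K) * (P - Q)).trace
      = (K' * P).trace - (K' * Q).trace - ((K * P).trace - (K * Q).trace) := by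
    rw [Matrix.sub_mul, Matrix.mul_sub, Matrix.mul_sub, trace_sub, trace_sub, trace_sub]
  set F := frobSq (P - Q) with hFdef
  set T := ((K' - K) * (P - Q)).trace
  have hF0 : 0 ≤ F := frobSq_nonneg _
  have hd : 0 < α - β := sub_pos.mpr hαβ
  -- Since tr Q ≤ |s| = tr P, F is at most 2(|s| − tr(PQ)). The gap inequality bounds this by the
  -- loss in tr(K·), and `hPQ` converts the loss into −T.
  have h1 : (α - β) * (F / 2) ≤ -T := by
    have : (α - β) * (F / 2) ≤ (α - β) * (s.card - (P * Q).trace) :=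
      mul_le_mul_of_nonneg_left (by linarith) hd.le
    linarith
  have h2 : ((α - β) * (F / 2)) ^ 2 ≤ frobSq (K' - K) * F := by
    have := pow_le_pow_left₀ (by positivity) h1 2
    rw [neg_sq] at this
    linarith
  rw [le_div_iff₀ (by positivity)]
  -- Cauchy–Schwarz gives (Δ/2)²F² ≤ ‖K' − K‖_F² F with Δ = α − β; cancelling one factor F requires
  -- F > 0.
  rcases hF0.eq_or_lt with h | h
  · rw [← h, zero_mul]
    have := frobSq_nonneg (K' - K)
    positivity
  · refine le_of_mul_le_mul_right ?_ h
    nlinarith [h2]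

end Perturbation

/-! ### The projection of principal component regression -/

section PCRProjection

variable {m p : Type*} [Fintype m] [Fintype p] {X : Matrix m p ℝ}

/-- The orthogonal projection `X V_k (X V_k)⁺` onto the range of `X V_k`. -/
noncomputable def ThinSVD.proj (S : ThinSVD X) (k : ℕ) : Matrix m m ℝ :=
  X * S.leadingV k * pinv (X * S.leadingV k)

theorem isOrthProj_mul_pinv (M : Matrix m p ℝ) : IsOrthProj (M * pinv M) :=
  ⟨(pinv_spec M).symm_left, by rw [← Matrix.mul_assoc, (pinv_spec M).mul_left]⟩

theorem ThinSVD.isOrthProj_proj (S : ThinSVD X) (k : ℕ) : IsOrthProj (S.proj k) :=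
  isOrthProj_mul_pinv _

/-- With J the inclusion of the first k coordinates, XV_k = UΣJ, and JᵀΣ⁺Uᵀ satisfies the Penrose
equations because diagonal matrices commute with JJᵀ. The factor σσ⁻¹ is 1 or 0, so vanishing
singular values among the first k contribute nothing. -/
theorem ThinSVD.proj_eq (S : ThinSVD X) (k : ℕ) :
    S.proj k = S.U * diagonal (fun i : Fin _ => if (i : ℕ) < k then S.σ i * (S.σ i)⁻¹ else 0) * S.Uᵀ := by
  set J : Matrix (Fin (min (Fintype.card m) (Fintype.card p)))
    {j : Fin (min (Fintype.card m) (Fintype.card p)) // (j : ℕ) < k} ℝ :=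
    (1 : Matrix _ _ ℝ).submatrix id Subtype.val with hJ
  have hV : S.leadingV k = S.V * J := by
    ext i j
    simp [ThinSVD.leadingV, hJ, Matrix.mul_apply, Matrix.one_apply]
  have hJJ : J * Jᵀ = diagonal (fun i : Fin _ => if (i : ℕ) < k then 1 else 0) := by
    ext i j
    rw [Matrix.mul_apply]
    by_cases hi : (i : ℕ) < k
    · rw [Finset.sum_eq_single (⟨i, hi⟩ : {j : Fin _ // (j : ℕ) < k})]
      · simp [hJ, Matrix.one_apply, Matrix.diagonal_apply, hi, eq_comm]
      · intro b _ hb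
        have : i ≠ b.1 := fun h => hb (Subtype.ext h.symm)
        simp [hJ, Matrix.one_apply, this]
      · simp
    · rw [Finset.sum_eq_zero]
      · simp [Matrix.diagonal_apply, hi]
      · intro b _
        have : i ≠ b.1 := fun h => hi (h ▸ b.2)
        simp [hJ, Matrix.one_apply, this]
  have hJJ' : Jᵀ * J = 1 := by
    ext i j
    simp [hJ, Matrix.mul_apply, Matrix.one_apply, Subtype.ext_iff]
  have comm : ∀ a : _ → ℝ, diagonal a * (J * Jᵀ) = (J * Jᵀ) * diagonal a := fun a => by
    rw [hJJ, diagonal_mul_diagonal, diagonal_mul_diagonal]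
    congr 1
    funext i
    ring
  have hM : X * S.leadingV k = S.U * diagonal S.σ * J := by
    rw [hV]
    calc X * (S.V * J) = S.U * diagonal S.σ * S.Vᵀ * (S.V * J) := by rw [← S.eq_mul]
      _ = S.U * diagonal S.σ * (S.Vᵀ * S.V) * J := by simp only [Matrix.mul_assoc]
      _ = _ := by rw [S.V_orthonormal, Matrix.mul_one]
  have h1 : S.U * diagonal S.σ * J * (Jᵀ * diagonal (fun i => (S.σ i)⁻¹) * S.Uᵀ)
      = S.U * diagonal (fun i : Fin _ => if (i : ℕ) < k then S.σ i * (S.σ i)⁻¹ else 0) * S.Uᵀ := by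
    calc S.U * diagonal S.σ * J * (Jᵀ * diagonal (fun i => (S.σ i)⁻¹) * S.Uᵀ)
        = S.U * (diagonal S.σ * (J * Jᵀ) * diagonal (fun i => (S.σ i)⁻¹)) * S.Uᵀ := by
          simp only [Matrix.mul_assoc]
      _ = _ := by
          rw [hJJ, diagonal_mul_diagonal, diagonal_mul_diagonal]
          congr 3
          funext i
          split_ifs <;> simp
  have h2 : (Jᵀ * diagonal (fun i => (S.σ i)⁻¹) * S.Uᵀ) * (S.U * diagonal S.σ * J)
      = Jᵀ * diagonal (fun i => (S.σ i)⁻¹ * S.σ i) * J := by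
    calc (Jᵀ * diagonal (fun i => (S.σ i)⁻¹) * S.Uᵀ) * (S.U * diagonal S.σ * J)
        = Jᵀ * diagonal (fun i => (S.σ i)⁻¹) * (S.Uᵀ * S.U) * diagonal S.σ * J := by
          simp only [Matrix.mul_assoc]
      _ = _ := by
          rw [S.U_orthonormal, Matrix.mul_one, Matrix.mul_assoc Jᵀ, diagonal_mul_diagonal]
  have hpinv : pinv (X * S.leadingV k) = Jᵀ * diagonal (fun i => (S.σ i)⁻¹) * S.Uᵀ := by
    rw [hM]
    refine (pinv_spec _).unique ⟨?_, ?_, ?_, ?_⟩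
    · rw [Matrix.mul_assoc, h2]
      calc S.U * diagonal S.σ * J * (Jᵀ * diagonal (fun i => (S.σ i)⁻¹ * S.σ i) * J)
          = S.U * diagonal S.σ * ((J * Jᵀ) * diagonal (fun i => (S.σ i)⁻¹ * S.σ i)) * J := by
            simp only [Matrix.mul_assoc]
        _ = S.U * (diagonal S.σ * diagonal (fun i => (S.σ i)⁻¹ * S.σ i)) * J * (Jᵀ * J) := by
            rw [← comm]; simp only [Matrix.mul_assoc]
        _ = _ := by
            rw [hJJ', Matrix.mul_one, diagonal_mul_diagonal]
            simp only [← mul_assoc, mul_inv_mul_cancel]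
    · rw [h2]
      calc Jᵀ * diagonal (fun i => (S.σ i)⁻¹ * S.σ i) * J
            * (Jᵀ * diagonal (fun i => (S.σ i)⁻¹) * S.Uᵀ)
          = Jᵀ * (diagonal (fun i => (S.σ i)⁻¹ * S.σ i) * (J * Jᵀ))
            * diagonal (fun i => (S.σ i)⁻¹) * S.Uᵀ := by simp only [Matrix.mul_assoc]
        _ = (Jᵀ * J) * Jᵀ * (diagonal (fun i => (S.σ i)⁻¹ * S.σ i)
            * diagonal (fun i => (S.σ i)⁻¹)) * S.Uᵀ := by
            rw [comm]; simp only [Matrix.mul_assoc]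
        _ = _ := by
            rw [hJJ', Matrix.one_mul, diagonal_mul_diagonal]
            congr 3
            funext i
            by_cases h : S.σ i = 0
            · simp [h]
            · field_simp
    · rw [h1]
      simp [Matrix.transpose_mul, Matrix.mul_assoc]
    · rw [h2]
      simp [Matrix.transpose_mul, Matrix.mul_assoc]
  rw [ThinSVD.proj, hpinv, hM, h1]

theorem ThinSVD.mul_transpose_eq (S : ThinSVD X) :
    X * Xᵀ = S.U * diagonal (fun i => S.σ i ^ 2) * S.Uᵀ := by
  calc X * Xᵀ = (S.U * diagonal S.σ * S.Vᵀ) * (S.U * diagonal S.σ * S.Vᵀ)ᵀ := by rw [← S.eq_mul]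
    _ = S.U * diagonal S.σ * (S.Vᵀ * S.V) * diagonal S.σ * S.Uᵀ := by
      simp [Matrix.transpose_mul, Matrix.mul_assoc]
    _ = _ := by
      rw [S.V_orthonormal, Matrix.mul_one, Matrix.mul_assoc S.U, diagonal_mul_diagonal]
      simp only [sq]

theorem card_filter_fin_lt (N k : ℕ) :
    (Finset.univ.filter fun i : Fin N => (i : ℕ) < k).card = min k N := by
  rw [Fin.card_filter_val_lt]
  exact min_comm _ _

theorem ThinSVD.trace_proj_le (S : ThinSVD X) (k : ℕ) : (S.proj k).trace ≤ k := by
  rw [S.proj_eq, trace_mul_comm, ← Matrix.mul_assoc, S.U_orthonormal, Matrix.one_mul,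
    trace_diagonal, ← Finset.sum_filter]
  calc ∑ i ∈ Finset.univ.filter (fun i : Fin (min (Fintype.card m) (Fintype.card p)) => (i : ℕ) < k),
          S.σ i * (S.σ i)⁻¹
      ≤ ∑ i ∈ Finset.univ.filter (fun i : Fin (min (Fintype.card m) (Fintype.card p)) => (i : ℕ) < k),
          (1 : ℝ) :=
        Finset.sum_le_sum fun i _ => mul_inv_le_one
    _ = min k (min (Fintype.card m) (Fintype.card p)) := by
        rw [Finset.sum_const, card_filter_fin_lt]; simp
    _ ≤ k := Nat.cast_le.mpr (min_le_left _ _)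

/-- For k < N this is `gap_sum_le` with both thresholds equal to the entry of index k, which makes
the gap term zero; for N ≤ k every index is selected and x ≤ 1 suffices. -/
theorem sum_antitone_mul_le {N : ℕ} (s : Fin N → ℝ) (hs : Antitone s) (hs0 : ∀ i, 0 ≤ s i)
    (x : Fin N → ℝ) (h0 : ∀ i, 0 ≤ x i) (h1 : ∀ i, x i ≤ 1) {k : ℕ} (hsum : ∑ i, x i ≤ k) :
    ∑ i, s i * x i ≤ ∑ i ∈ Finset.univ.filter (fun i : Fin N => (i : ℕ) < k), s i := by
  rcases le_or_gt N k with hk | hk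
  · rw [Finset.filter_true_of_mem fun i _ => i.2.trans_le hk]
    exact Finset.sum_le_sum fun i _ => mul_le_of_le_one_right (hs0 i) (h1 i)
  · have hc := card_filter_fin_lt N k
    rw [min_eq_left hk.le] at hc
    have := gap_sum_le (Finset.univ.filter fun i : Fin N => (i : ℕ) < k) s x
      (α := s ⟨k, hk⟩) (β := s ⟨k, hk⟩) (hs0 _)
      (fun i hi => hs (by simpa [Fin.le_def] using (by simpa using hi : (i : ℕ) < k).le))
      (fun i hi => hs (by simpa [Fin.le_def] using hi)) h0 h1 (by rw [hc]; exact hsum)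
    simpa using this

/-- The Ky Fan principle: the PCR projection captures at least as much of `X Xᵀ` as any
projection of rank at most `k`. -/
theorem ThinSVD.trace_mul_le_trace_mul_proj (S : ThinSVD X) (k : ℕ) {P : Matrix m m ℝ}
    (hP : IsOrthProj P) (hPk : P.trace ≤ k) :
    (X * Xᵀ * P).trace ≤ (X * Xᵀ * S.proj k).trace := by
  rw [S.mul_transpose_eq, trace_mul_diagonal_conj, trace_mul_diagonal_conj, S.proj_eq]
  have h := sum_antitone_mul_le (fun i => S.σ i ^ 2)
    (fun i j hij => pow_le_pow_left₀ (S.σ_nonneg j) (S.σ_antitone hij) 2) (fun i => sq_nonneg _)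
    (fun i => (S.Uᵀ * P * S.U) i i) (fun i => (hP.diag_conj_mem S.U_orthonormal i).1)
    (fun i => (hP.diag_conj_mem S.U_orthonormal i).2)
    ((trace_conj_le S.U_orthonormal hP).trans hPk)
  refine h.trans (le_of_eq ?_)
  have e : ∀ a : Fin (min (Fintype.card m) (Fintype.card p)) → ℝ,
      S.Uᵀ * (S.U * diagonal a * S.Uᵀ) * S.U = diagonal a := fun a => by
    rw [Matrix.mul_assoc S.U, ← Matrix.mul_assoc S.Uᵀ, S.U_orthonormal, Matrix.one_mul,
      Matrix.mul_assoc, S.U_orthonormal, Matrix.mul_one]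
  rw [e, Finset.sum_filter]
  refine Finset.sum_congr rfl fun i _ => ?_
  rw [diagonal_apply_eq]
  split_ifs
  · by_cases h : S.σ i = 0
    · simp [h]
    · field_simp
  · simp

end PCRProjection

/-! ### Moments of `r`-wise independent families -/

section Moments

variable {Ω : Type*} [MeasurableSpace Ω] {P : Measure Ω}

instance : DiscreteMeasurableSpace ℤˣ where
  forall_measurableSet s := by
    rw [show s = Units.val ⁻¹' (Units.val '' s) from
      (Set.preimage_image_eq s Units.val_injective).symm]
    exact ⟨_, trivial, rfl⟩

theorem measurable_comp_of_finite {S E : Type*} [Finite S] [MeasurableSpace S]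
    [MeasurableSingletonClass S] [MeasurableSpace E] {X : Ω → S} (hX : Measurable X) (F : S → E) :
    Measurable fun ω => F (X ω) :=
  (measurable_of_finite F).comp hX

theorem integrable_comp_of_finite [IsFiniteMeasure P] {S E : Type*} [Finite S]
    [MeasurableSpace S] [MeasurableSingletonClass S] [NormedAddCommGroup E]
    {X : Ω → S} (hX : Measurable X) (F : S → E) : Integrable (fun ω => F (X ω)) P := by
  have : Integrable F (P.map X) := by
    have := Measure.isFiniteMeasure_map P X
    exact Integrable.of_finite
  exact this.comp_measurable hX

/-- The joint law of the at most r variables indexed by s is uniform on functions s → β, so the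
expectation is a normalized sum over such functions, which factors by distributivity. -/
theorem IsKWiseIndependent.integral_prod [IsProbabilityMeasure P] {ι β : Type*} [Fintype β]
    [MeasurableSpace β] [DiscreteMeasurableSpace β] {r : ℕ} {X : ι → Ω → β}
    (hX : IsKWiseIndependent P r X) (hXm : ∀ i, Measurable (X i)) (s : Finset ι)
    (hs : s.card ≤ r) (f : ι → β → ℂ) :
    ∫ ω, ∏ i ∈ s, f i (X i ω) ∂P = ∏ i ∈ s, ((Fintype.card β : ℂ)⁻¹ * ∑ b, f i b) := by
  classical
  have hβ : Nonempty ι → Nonempty β := fun ⟨i⟩ => by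
    have : Nonempty Ω := nonempty_of_isProbabilityMeasure P
    exact this.map (X i)
  have hm : Measurable fun ω (i : s) => X i ω := measurable_pi_lambda _ fun i => hXm i
  have h1 : ∫ ω, ∏ i ∈ s, f i (X i ω) ∂P
      = ∫ y, ∏ i : s, f i (y i) ∂(P.map fun ω (i : s) => X i ω) := by
    rw [integral_map hm.aemeasurable (measurable_of_finite _).aestronglyMeasurable]
    refine integral_congr_ae (Filter.Eventually.of_forall fun ω => ?_)
    exact (Finset.prod_coe_sort s fun i => f i (X i ω)).symm
  have := Measure.isFiniteMeasure_map P fun ω (i : s) => X i ω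
  rw [h1, integral_fintype Integrable.of_finite]
  have h2 : ∀ y : s → β, (P.map fun ω (i : s) => X i ω).real {y}
      = ((Fintype.card β : ℝ)⁻¹) ^ s.card := by
    intro y
    rw [map_measureReal_apply hm (measurableSet_singleton y), measureReal_def]
    by_cases hne : Nonempty ι
    · have hβ := hβ hne
      -- The definition of independence tests against functions on all of ι, so y is extended
      -- arbitrarily outside s.
      set y' : ι → β := fun i => if h : i ∈ s then y ⟨i, h⟩ else Classical.arbitrary β with hy'
      have e : (fun ω (i : s) => X i ω) ⁻¹' {y} = {ω | ∀ i ∈ s, X i ω = y' i} := by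
        ext ω
        simp only [Set.mem_preimage, Set.mem_singleton_iff, Set.mem_ofPred_eq, funext_iff,
          Subtype.forall, hy']
        refine forall_congr' fun i => forall_congr' fun hi => ?_
        simp [hi]
      rw [e, hX s hs y']
      simp
    · have hs0 : s = ∅ := by
        rw [not_nonempty_iff] at hne
        exact Finset.eq_empty_of_isEmpty s
      subst hs0
      have : (fun ω (i : (∅ : Finset ι)) => X i ω) ⁻¹' {y} = Set.univ := by
        ext ω
        simp only [Set.mem_preimage, Set.mem_singleton_iff, Set.mem_univ, iff_true]
        exact Subsingleton.elim _ _
      rw [this]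
      simp
  simp only [h2]
  rw [← Finset.smul_sum, Finset.prod_mul_distrib, Finset.prod_const]
  have h3 := Finset.prod_univ_sum (fun _ : s => (Finset.univ : Finset β)) (fun i b => f i b)
  rw [Fintype.piFinset_univ] at h3
  rw [← h3, Finset.prod_coe_sort s fun i => ∑ b, f i b, Complex.real_smul]
  push_cast
  rfl

end Moments

/-! ### Fourier expansion of TensorSketch -/

section Fourier

variable {q d t : ℕ} [NeZero t]

/-- The Fourier transform at `w` of the count sketch of `a` with hash `h` and signs `g`. -/
noncomputable def sketchChar (a : Fin d → ℝ) (h : Fin d → ZMod t) (g : Fin d → ℤˣ) (w : ZMod t) :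
    ℂ :=
  ∑ i, (a i : ℂ) * (((g i : ℤ) : ℂ) * ZMod.stdAddChar (w * h i))

theorem addChar_map_sum {A M ι : Type*} [AddCommMonoid A] [CommMonoid M]
    (ψ : AddChar A M) (s : Finset ι) (f : ι → A) : ψ (∑ i ∈ s, f i) = ∏ i ∈ s, ψ (f i) := by
  classical
  induction s using Finset.induction_on with
  | empty => simp
  | insert a s ha ih =>
    rw [Finset.sum_insert ha, Finset.prod_insert ha, AddChar.map_add_eq_mul, ih]

theorem sum_stdAddChar_mul (b : ZMod t) :
    ∑ w : ZMod t, ZMod.stdAddChar (w * b) = if b = 0 then (t : ℂ) else 0 := by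
  rw [AddChar.sum_mulShift b (ZMod.isPrimitive_stdAddChar t), ZMod.card]
  split_ifs <;> simp

/-- Orthogonality of characters collapses the double sum to the diagonal. The frequency −w replaces
complex conjugation, which keeps the identity bilinear. -/
theorem zmod_parseval (u v : ZMod t → ℂ) :
    ∑ j, u j * v j = (t : ℂ)⁻¹ * ∑ w, (∑ j, u j * ZMod.stdAddChar (w * j))
      * ∑ j, v j * ZMod.stdAddChar (-w * j) := by
  have ht : (t : ℂ) ≠ 0 := Nat.cast_ne_zero.mpr (NeZero.ne t)
  have h1 : ∑ w : ZMod t, (∑ j, u j * ZMod.stdAddChar (w * j))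
      * ∑ j, v j * ZMod.stdAddChar (-w * j) = ∑ i, ∑ j, u i * v j * if i - j = 0 then (t : ℂ) else 0 := by
    simp only [Finset.sum_mul_sum]
    rw [Finset.sum_comm]
    refine Finset.sum_congr rfl fun i _ => ?_
    rw [Finset.sum_comm]
    refine Finset.sum_congr rfl fun j _ => ?_
    rw [← sum_stdAddChar_mul, Finset.mul_sum]
    refine Finset.sum_congr rfl fun w _ => ?_
    rw [show w * (i - j) = w * i + -w * j by ring, AddChar.map_add_eq_mul]
    ring
  rw [h1]
  simp only [sub_eq_zero, mul_ite, mul_zero, Finset.sum_ite_eq, Finset.mem_univ, if_true]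
  rw [← Finset.sum_mul]
  field_simp

/-- Hashes of multi-indices add and signs multiply, so the sketch of a pure tensor is the circular
convolution of q count sketches; a character turns convolution into a product. -/
theorem polyFeature_vecMul_tensorSketch_char (a : Fin d → ℝ) (h : Fin q → Fin d → ZMod t)
    (g : Fin q → Fin d → ℤˣ) (w : ZMod t) :
    ∑ j, (((polyFeature q a ᵥ* tensorSketch h g) j : ℝ) : ℂ) * ZMod.stdAddChar (w * j)
      = ∏ c, sketchChar a (h c) (g c) w := by
  simp only [sketchChar]
  rw [Finset.prod_univ_sum, Fintype.piFinset_univ]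
  simp only [vecMul, dotProduct, tensorSketch, of_apply, Complex.ofReal_sum, Finset.sum_mul]
  rw [Finset.sum_comm]
  refine Finset.sum_congr rfl fun I _ => ?_
  rw [Finset.sum_eq_single (∑ c, h c (I c))]
  · simp only [if_true, polyFeature, Finset.prod_mul_distrib, Complex.ofReal_mul,
      Complex.ofReal_prod, Complex.ofReal_intCast, Finset.mul_sum]
    rw [addChar_map_sum, mul_assoc]
  · intro j _ hj
    simp [hj]
  · simp

theorem tensorSketch_inner_eq (a b : Fin d → ℝ) (h : Fin q → Fin d → ZMod t)
    (g : Fin q → Fin d → ℤˣ) :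
    (((polyFeature q a ᵥ* tensorSketch h g) ⬝ᵥ (polyFeature q b ᵥ* tensorSketch h g) : ℝ) : ℂ)
      = (t : ℂ)⁻¹ * ∑ w, ∏ c, (sketchChar a (h c) (g c) w * sketchChar b (h c) (g c) (-w)) := by
  simp only [Finset.prod_mul_distrib, ← polyFeature_vecMul_tensorSketch_char]
  rw [← zmod_parseval]
  simp [dotProduct]

end Fourier

/-! ### Moments of TensorSketch -/

section SketchMoments

variable {q d t : ℕ} [NeZero t] {Ω : Type*} [MeasurableSpace Ω] {P : Measure Ω}
  [IsProbabilityMeasure P] {h : Fin q → Fin d → Ω → ZMod t} {g : Fin q → Fin d → Ω → ℤˣ}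

/-- The product is expanded over choices of one τ per factor. Independence separates signs from
hashes and then the factors c from each other, after which the sum is folded back. -/
theorem IsTensorSketchHashing.integral_prod_sum (H : IsTensorSketchHashing P h g)
    {κ : Type*} [Fintype κ] (coef : κ → ℂ) (γ : κ → (Fin d → ℤˣ) → ℂ)
    (η : κ → (Fin d → ZMod t) → ℂ) :
    ∫ ω, ∏ c, ∑ τ, coef τ * (γ τ (fun i => g c i ω) * η τ (fun i => h c i ω)) ∂P
      = ∏ c, ∑ τ, coef τ * ((∫ ω, γ τ (fun i => g c i ω) ∂P) * ∫ ω, η τ (fun i => h c i ω) ∂P) := by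
  classical
  have mh : ∀ c, Measurable fun ω i => h c i ω := fun c =>
    measurable_pi_lambda _ fun i => H.measurable_h c i
  have mg : ∀ c, Measurable fun ω i => g c i ω := fun c =>
    measurable_pi_lambda _ fun i => H.measurable_g c i
  have mh' : Measurable fun ω c i => h c i ω := measurable_pi_lambda _ fun c => mh c
  have mg' : Measurable fun ω c i => g c i ω := measurable_pi_lambda _ fun c => mg c
  have mF : ∀ {S : Type} [Finite S] [MeasurableSpace S] [MeasurableSingletonClass S]
      (ν : Measure S) (F : S → ℂ), AEStronglyMeasurable F ν := fun ν F =>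
    (measurable_of_finite F).aestronglyMeasurable
  simp only [Finset.prod_univ_sum, Fintype.piFinset_univ]
  rw [integral_finsetSum]
  · refine Finset.sum_congr rfl fun x _ => ?_
    simp only [Finset.prod_mul_distrib]
    rw [integral_const_mul]
    congr 1
    have hi := (H.indep_h_g.symm.comp
      (φ := fun G : Fin q → Fin d → ℤˣ => ∏ c, γ (x c) (G c))
      (ψ := fun G : Fin q → Fin d → ZMod t => ∏ c, η (x c) (G c))
      (measurable_of_finite _) (measurable_of_finite _))
    have e := hi.integral_fun_mul_eq_mul_integral
      ((measurable_of_finite _).comp mg').aestronglyMeasurable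
      ((measurable_of_finite _).comp mh').aestronglyMeasurable
    simp only [Function.comp_def] at e
    rw [e]
    congr 1
    · exact H.indep_g.integral_fun_prod_comp (f := fun c => γ (x c))
        (fun c => (mg c).aemeasurable) fun c => mF _ _
    · exact H.indep_h.integral_fun_prod_comp (f := fun c => η (x c))
        (fun c => (mh c).aemeasurable) fun c => mF _ _
  · intro x _
    exact integrable_comp_of_finite (mg'.prodMk mh')
      fun S => ∏ c, coef (x c) * (γ (x c) (S.1 c) * η (x c) (S.2 c))

theorem integral_prod_sign {X : Fin d → Ω → ℤˣ} (hX : IsKWiseIndependent P 4 X)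
    (hXm : ∀ i, Measurable (X i)) (s : Finset (Fin d)) (hs : s.card ≤ 4) (hne : s.Nonempty) :
    ∫ ω, ∏ i ∈ s, ((X i ω : ℤ) : ℂ) ∂P = 0 := by
  rw [hX.integral_prod hXm s hs fun _ x => ((x : ℤ) : ℂ)]
  obtain ⟨i, hi⟩ := hne
  refine Finset.prod_eq_zero hi ?_
  have : (Finset.univ : Finset ℤˣ) = {1, -1} := rfl
  simp [this]

theorem intCast_units_mul_self (x : ℤˣ) : ((x : ℤ) : ℂ) * ((x : ℤ) : ℂ) = 1 := by
  rcases Int.units_eq_one_or x with h | h <;> simp [h]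

theorem integral_sign_mul {X : Fin d → Ω → ℤˣ} (hX : IsKWiseIndependent P 4 X)
    (hXm : ∀ i, Measurable (X i)) (i j : Fin d) :
    ∫ ω, ((X i ω : ℤ) : ℂ) * ((X j ω : ℤ) : ℂ) ∂P = if i = j then 1 else 0 := by
  split_ifs with h
  · subst h
    simp [intCast_units_mul_self]
  · have := integral_prod_sign hX hXm {i, j} (Finset.card_le_two.trans (by norm_num)) (by simp)
    simpa [Finset.prod_pair h] using this

/-- Equal signs cancel in pairs because they square to 1; any sign left over has mean zero, and four
distinct indices use the full 4-wise independence. -/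
theorem integral_sign_mul_four {X : Fin d → Ω → ℤˣ} (hX : IsKWiseIndependent P 4 X)
    (hXm : ∀ i, Measurable (X i)) (i j k l : Fin d) :
    ∫ ω, ((X i ω : ℤ) : ℂ) * ((X j ω : ℤ) : ℂ) * (((X k ω : ℤ) : ℂ) * ((X l ω : ℤ) : ℂ)) ∂P
      = if (i = j ∧ k = l) ∨ (i = k ∧ j = l) ∨ (i = l ∧ j = k) then 1 else 0 := by
  have h2 := integral_sign_mul hX hXm
  by_cases hij : i = j
  · subst hij
    simp only [intCast_units_mul_self, one_mul, h2]
    by_cases hkl : k = l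
    · simp [hkl]
    · have : ¬ (i = k ∧ i = l) := fun h => hkl (h.1.symm.trans h.2)
      have : ¬ (i = l ∧ i = k) := fun h => hkl (h.2.symm.trans h.1)
      simp [*]
  by_cases hik : i = k
  · subst hik
    have : ∀ x y z : ℂ, x * y * (x * z) = x * x * y * z := fun x y z => by ring
    simp only [this, intCast_units_mul_self, one_mul, h2, hij, false_and, false_or, true_and]
    by_cases hjl : j = l
    · simp [hjl]
    · have : ¬ (i = l ∧ j = i) := fun h => hij h.2.symm
      simp [*]
  by_cases hil : i = l
  · subst hil
    have : ∀ x y z : ℂ, x * y * (z * x) = x * x * y * z := fun x y z => by ring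
    simp only [this, intCast_units_mul_self, one_mul, h2, hij, hik, false_and, false_or, true_and]
  have hR : ¬ ((i = j ∧ k = l) ∨ (i = k ∧ j = l) ∨ (i = l ∧ j = k)) := by tauto
  rw [if_neg hR]
  by_cases hjk : j = k
  · subst hjk
    have : ∀ x y z : ℂ, x * y * (y * z) = y * y * x * z := fun x y z => by ring
    simp only [this, intCast_units_mul_self, one_mul, h2, hil, if_false]
  by_cases hjl : j = l
  · subst hjl
    have : ∀ x y z : ℂ, x * y * (z * y) = y * y * x * z := fun x y z => by ring
    simp only [this, intCast_units_mul_self, one_mul, h2, hik, if_false]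
  by_cases hkl : k = l
  · subst hkl
    simp only [intCast_units_mul_self, mul_one, h2, hij, if_false]
  have := integral_prod_sign hX hXm {i, j, k, l} Finset.card_le_four (by simp)
  rw [← this]
  refine integral_congr_ae (Filter.Eventually.of_forall fun ω => ?_)
  simp only
  rw [Finset.prod_insert (by simp [*]), Finset.prod_insert (by simp [*]), Finset.prod_pair hkl]
  ring

theorem integral_hash_char {X : Fin d → Ω → ZMod t} (hX : IsKWiseIndependent P 3 X)
    (hXm : ∀ i, Measurable (X i)) {i j : Fin d} (hij : i ≠ j) (w : ZMod t) :
    ∫ ω, ZMod.stdAddChar (w * (X i ω - X j ω)) ∂P = if w = 0 then 1 else 0 := by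
  have ht : (t : ℂ) ≠ 0 := Nat.cast_ne_zero.mpr (NeZero.ne t)
  have h1 := hX.integral_prod hXm {i, j} (Finset.card_le_two.trans (by norm_num))
    fun a x => if a = i then ZMod.stdAddChar (x * w) else ZMod.stdAddChar (x * -w)
  simp only [Finset.prod_pair hij, if_true, hij.symm, if_false, sum_stdAddChar_mul,
    neg_eq_zero, ZMod.card] at h1
  have h2 : ∀ x y : ZMod t, (ZMod.stdAddChar (w * (x - y)) : ℂ)
      = ZMod.stdAddChar (x * w) * ZMod.stdAddChar (y * -w) := fun x y => by
    rw [← AddChar.map_add_eq_mul]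
    congr 1
    ring
  simp only [h2, h1]
  split_ifs <;> simp [ht]

end SketchMoments

/-! ### The variance of TensorSketch -/

section SketchVariance

variable {q d t : ℕ} [NeZero t] {Ω : Type*} [MeasurableSpace Ω] {P : Measure Ω}
  [IsProbabilityMeasure P] {h : Fin q → Fin d → Ω → ZMod t} {g : Fin q → Fin d → Ω → ℤˣ}

/-- The expected product of two signs and a character of two hash values. -/
theorem integral_sign_mul_hash {X : Fin d → Ω → ℤˣ} (hX : IsKWiseIndependent P 4 X)
    (hXm : ∀ i, Measurable (X i)) (Y : Fin d → Ω → ZMod t) (w : ZMod t) (i j : Fin d) :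
    (∫ ω, ((X i ω : ℤ) : ℂ) * ((X j ω : ℤ) : ℂ) ∂P)
      * (∫ ω, (ZMod.stdAddChar (w * (Y i ω - Y j ω)) : ℂ) ∂P) = if i = j then 1 else 0 := by
  rw [integral_sign_mul hX hXm]
  split_ifs with h
  · subst h
    simp
  · simp

/-- The expected product of four signs and a character of four hash values. -/
theorem integral_sign_mul_four_hash {X : Fin d → Ω → ℤˣ} (hX : IsKWiseIndependent P 4 X)
    (hXm : ∀ i, Measurable (X i)) {Y : Fin d → Ω → ZMod t} (hY : IsKWiseIndependent P 3 Y)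
    (hYm : ∀ i, Measurable (Y i)) (w w' : ZMod t) (i j k l : Fin d) :
    (∫ ω, ((X i ω : ℤ) : ℂ) * ((X j ω : ℤ) : ℂ) * (((X k ω : ℤ) : ℂ) * ((X l ω : ℤ) : ℂ)) ∂P)
      * (∫ ω, (ZMod.stdAddChar (w * (Y i ω - Y j ω) + w' * (Y k ω - Y l ω)) : ℂ) ∂P)
      = if i = j ∧ k = l then 1 else if i = k ∧ j = l then (if w + w' = 0 then 1 else 0)
        else if i = l ∧ j = k then (if w - w' = 0 then 1 else 0) else 0 := by
  rw [integral_sign_mul_four hX hXm]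
  by_cases h1 : i = j ∧ k = l
  · obtain ⟨rfl, rfl⟩ := h1
    simp
  -- In each remaining pairing only two distinct hash values survive, and the exponent collapses to
  -- (w + w')(Y_i − Y_j) here and to (w − w')(Y_i − Y_j) in the next case.
  by_cases h2 : i = k ∧ j = l
  · obtain ⟨rfl, rfl⟩ := h2
    have hij : i ≠ j := fun h => h1 ⟨h, h⟩
    rw [if_pos (by tauto), if_neg h1, if_pos ⟨rfl, rfl⟩, one_mul,
      ← integral_hash_char hY hYm hij]
    simp only [add_mul]
  by_cases h3 : i = l ∧ j = k
  · obtain ⟨rfl, rfl⟩ := h3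
    have hij : i ≠ j := fun h => h1 ⟨h, h.symm⟩
    rw [if_pos (by tauto), if_neg h1, if_neg h2, if_pos ⟨rfl, rfl⟩, one_mul,
      ← integral_hash_char hY hYm hij]
    refine integral_congr_ae (Filter.Eventually.of_forall fun ω => ?_)
    simp only
    congr 1
    ring
  · rw [if_neg (by tauto), if_neg h1, if_neg h2, if_neg h3, zero_mul]

/-- The second moment of one factor of the Fourier expansion. -/
noncomputable def factorMoment (a b : Fin d → ℝ) (w w' : ZMod t) : ℂ :=
  ∑ x : Fin d × Fin d × Fin d × Fin d,
    (a x.1 * b x.2.1 * (a x.2.2.1 * b x.2.2.2) : ℂ) *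
      if x.1 = x.2.1 ∧ x.2.2.1 = x.2.2.2 then 1
      else if x.1 = x.2.2.1 ∧ x.2.1 = x.2.2.2 then (if w + w' = 0 then 1 else 0)
      else if x.1 = x.2.2.2 ∧ x.2.1 = x.2.2.1 then (if w - w' = 0 then 1 else 0) else 0

/-- Away from w' = ±w only the pairing i = j, k = l survives, so the second moment is the square of
the mean: the two frequencies are uncorrelated. -/
theorem factorMoment_eq_sq {s : ℕ} (a b : Fin d → ℝ) {w w' : ZMod s} (h1 : w + w' ≠ 0)
    (h2 : w - w' ≠ 0) : factorMoment a b w w' = ((a ⬝ᵥ b : ℝ) : ℂ) ^ 2 := by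
  simp only [factorMoment, h1, h2, if_false, ite_self, Fintype.sum_prod_type, ite_and, mul_ite,
    mul_one, mul_zero]
  rw [sq, dotProduct]
  push_cast
  rw [Finset.sum_mul_sum]
  simp

/-- Each of the three pairings contributes at most ‖a‖²‖b‖², by Cauchy–Schwarz where needed. This is
the source of 3^q. -/
theorem norm_factorMoment_le {s : ℕ} (a b : Fin d → ℝ) (w w' : ZMod s) :
    ‖factorMoment a b w w'‖ ≤ 3 * ((a ⬝ᵥ a) * (b ⬝ᵥ b)) := by
  have hcs : (∑ i, |a i| * |b i|) ^ 2 ≤ (a ⬝ᵥ a) * (b ⬝ᵥ b) := by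
    simpa [dotProduct, sq] using Finset.sum_mul_sq_le_sq_mul_sq Finset.univ (|a ·|) (|b ·|)
  have e1 : ∑ i, ∑ j, ∑ k, ∑ l, |a i| * |b j| * (|a k| * |b l|) * (if i = j ∧ k = l then 1 else 0)
      = (∑ i, |a i| * |b i|) ^ 2 := by
    simp only [ite_and, mul_ite, mul_one, mul_zero]
    rw [sq, Finset.sum_mul_sum]
    refine Finset.sum_congr rfl fun i _ => ?_
    rw [Finset.sum_comm]
    simp
  have e2 : ∑ i, ∑ j, ∑ k, ∑ l, |a i| * |b j| * (|a k| * |b l|) * (if i = k ∧ j = l then 1 else 0)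
      = (a ⬝ᵥ a) * (b ⬝ᵥ b) := by
    simp only [ite_and, mul_ite, mul_one, mul_zero, Finset.sum_ite_eq, Finset.mem_univ, if_true,
      Finset.sum_ite_irrel, Finset.sum_const_zero]
    rw [dotProduct, dotProduct, Finset.sum_mul_sum]
    refine Finset.sum_congr rfl fun i _ => Finset.sum_congr rfl fun j _ => ?_
    rw [mul_mul_mul_comm, abs_mul_abs_self, abs_mul_abs_self]
  have e3 : ∑ i, ∑ j, ∑ k, ∑ l, |a i| * |b j| * (|a k| * |b l|) * (if i = l ∧ j = k then 1 else 0)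
      = (∑ i, |a i| * |b i|) ^ 2 := by
    simp only [ite_and, mul_ite, mul_one, mul_zero, Finset.sum_ite_eq, Finset.mem_univ, if_true]
    rw [sq, Finset.sum_mul_sum]
    exact Finset.sum_congr rfl fun i _ => Finset.sum_congr rfl fun j _ => by ring
  refine (norm_sum_le _ _).trans ?_
  have key : ∀ x : Fin d × Fin d × Fin d × Fin d,
      ‖(a x.1 * b x.2.1 * (a x.2.2.1 * b x.2.2.2) : ℂ) *
        if x.1 = x.2.1 ∧ x.2.2.1 = x.2.2.2 then 1
        else if x.1 = x.2.2.1 ∧ x.2.1 = x.2.2.2 then (if w + w' = 0 then 1 else 0)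
        else if x.1 = x.2.2.2 ∧ x.2.1 = x.2.2.1 then (if w - w' = 0 then 1 else 0) else 0‖
      ≤ |a x.1| * |b x.2.1| * (|a x.2.2.1| * |b x.2.2.2|) *
          (if x.1 = x.2.1 ∧ x.2.2.1 = x.2.2.2 then 1 else 0)
        + |a x.1| * |b x.2.1| * (|a x.2.2.1| * |b x.2.2.2|) *
          (if x.1 = x.2.2.1 ∧ x.2.1 = x.2.2.2 then 1 else 0)
        + |a x.1| * |b x.2.1| * (|a x.2.2.1| * |b x.2.2.2|) *
          (if x.1 = x.2.2.2 ∧ x.2.1 = x.2.2.1 then 1 else 0) := by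
    rintro ⟨i, j, k, l⟩
    simp only [norm_mul, Complex.norm_real, Real.norm_eq_abs]
    rw [← mul_add, ← mul_add]
    refine mul_le_mul_of_nonneg_left ?_ (by positivity)
    split_ifs <;> simp
  refine (Finset.sum_le_sum fun x _ => key x).trans ?_
  rw [Finset.sum_add_distrib, Finset.sum_add_distrib]
  simp only [Fintype.sum_prod_type]
  rw [e1, e2, e3]
  linarith

theorem sketchChar_mul (a b : Fin d → ℝ) (h : Fin d → ZMod t) (g : Fin d → ℤˣ) (w : ZMod t) :
    sketchChar a h g w * sketchChar b h g (-w) = ∑ x : Fin d × Fin d, (a x.1 * b x.2 : ℂ) *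
      ((((g x.1 : ℤ) : ℂ) * ((g x.2 : ℤ) : ℂ)) * ZMod.stdAddChar (w * (h x.1 - h x.2))) := by
  rw [sketchChar, sketchChar, Finset.sum_mul_sum, Fintype.sum_prod_type]
  refine Finset.sum_congr rfl fun i _ => Finset.sum_congr rfl fun j _ => ?_
  rw [mul_sub, sub_eq_add_neg, ← neg_mul, AddChar.map_add_eq_mul]
  ring

theorem sketchChar_mul_four (a b : Fin d → ℝ) (h : Fin d → ZMod t) (g : Fin d → ℤˣ)
    (w w' : ZMod t) :
    sketchChar a h g w * sketchChar b h g (-w) * (sketchChar a h g w' * sketchChar b h g (-w'))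
      = ∑ x : Fin d × Fin d × Fin d × Fin d, (a x.1 * b x.2.1 * (a x.2.2.1 * b x.2.2.2) : ℂ) *
      ((((g x.1 : ℤ) : ℂ) * ((g x.2.1 : ℤ) : ℂ) *
        (((g x.2.2.1 : ℤ) : ℂ) * ((g x.2.2.2 : ℤ) : ℂ))) *
        ZMod.stdAddChar (w * (h x.1 - h x.2.1) + w' * (h x.2.2.1 - h x.2.2.2))) := by
  rw [sketchChar_mul, sketchChar_mul]
  simp only [Fintype.sum_prod_type, Finset.sum_mul]
  simp only [Finset.mul_sum]
  refine Finset.sum_congr rfl fun i _ => Finset.sum_congr rfl fun j _ =>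
    Finset.sum_congr rfl fun k _ => Finset.sum_congr rfl fun l _ => ?_
  rw [AddChar.map_add_eq_mul]
  ring

theorem IsTensorSketchHashing.integral_prod_sketchChar (H : IsTensorSketchHashing P h g)
    (a b : Fin d → ℝ) (w : ZMod t) :
    ∫ ω, ∏ c, (sketchChar a (fun i => h c i ω) (fun i => g c i ω) w
      * sketchChar b (fun i => h c i ω) (fun i => g c i ω) (-w)) ∂P
      = ((a ⬝ᵥ b : ℝ) : ℂ) ^ q := by
  simp only [sketchChar_mul]
  rw [H.integral_prod_sum (fun x : Fin d × Fin d => (a x.1 * b x.2 : ℂ))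
    (fun x G => ((G x.1 : ℤ) : ℂ) * ((G x.2 : ℤ) : ℂ))
    (fun x G => ZMod.stdAddChar (w * (G x.1 - G x.2)))]
  simp only [integral_sign_mul_hash (H.sign _) (H.measurable_g _), Fintype.sum_prod_type,
    mul_ite, mul_one, mul_zero, Finset.sum_ite_eq, Finset.mem_univ, if_true, Finset.prod_const,
    Finset.card_univ, Fintype.card_fin]
  simp [dotProduct]

theorem IsTensorSketchHashing.integral_prod_sketchChar_mul (H : IsTensorSketchHashing P h g)
    (a b : Fin d → ℝ) (w w' : ZMod t) :
    ∫ ω, (∏ c, (sketchChar a (fun i => h c i ω) (fun i => g c i ω) w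
        * sketchChar b (fun i => h c i ω) (fun i => g c i ω) (-w)))
      * ∏ c, (sketchChar a (fun i => h c i ω) (fun i => g c i ω) w'
        * sketchChar b (fun i => h c i ω) (fun i => g c i ω) (-w')) ∂P
      = factorMoment a b w w' ^ q := by
  simp only [← Finset.prod_mul_distrib, sketchChar_mul_four]
  rw [H.integral_prod_sum
    (fun x : Fin d × Fin d × Fin d × Fin d => (a x.1 * b x.2.1 * (a x.2.2.1 * b x.2.2.2) : ℂ))
    (fun x G => ((G x.1 : ℤ) : ℂ) * ((G x.2.1 : ℤ) : ℂ) *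
      (((G x.2.2.1 : ℤ) : ℂ) * ((G x.2.2.2 : ℤ) : ℂ)))
    (fun x G => ZMod.stdAddChar (w * (G x.1 - G x.2.1) + w' * (G x.2.2.1 - G x.2.2.2)))]
  simp only [integral_sign_mul_four_hash (H.sign _) (H.measurable_g _) (H.hash _)
    (H.measurable_h _), Finset.prod_const, Finset.card_univ, Fintype.card_fin]
  rfl

/-- Terms vanish off the two lines w' = ±w. Each line has t points, and each term there is at most
2·3^q(‖a‖²‖b‖²)^q, which gives 4t. -/
theorem norm_sum_factorMoment_sub_le (a b : Fin d → ℝ) (q : ℕ) :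
    ‖∑ w : ZMod t, ∑ w' : ZMod t, (factorMoment a b w w' ^ q - ((a ⬝ᵥ b : ℝ) : ℂ) ^ (2 * q))‖
      ≤ 4 * t * (3 ^ q * ((a ⬝ᵥ a) * (b ⬝ᵥ b)) ^ q) := by
  set u := (a ⬝ᵥ a) * (b ⬝ᵥ b) with hu
  have hu0 : 0 ≤ u := mul_nonneg (Finset.sum_nonneg fun _ _ => mul_self_nonneg _)
    (Finset.sum_nonneg fun _ _ => mul_self_nonneg _)
  have key : ∀ w w' : ZMod t,
      ‖factorMoment a b w w' ^ q - ((a ⬝ᵥ b : ℝ) : ℂ) ^ (2 * q)‖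
        ≤ (if w' = -w then 2 * (3 ^ q * u ^ q) else 0) + if w' = w then 2 * (3 ^ q * u ^ q) else 0 := by
    intro w w'
    have hB : 0 ≤ 2 * (3 ^ q * u ^ q) := by positivity
    by_cases hw : w' = -w ∨ w' = w
    · have h1 : ‖factorMoment a b w w' ^ q‖ ≤ 3 ^ q * u ^ q := by
        rw [norm_pow, ← mul_pow]
        exact pow_le_pow_left₀ (norm_nonneg _) (norm_factorMoment_le a b w w') q
      have h2 : ‖((a ⬝ᵥ b : ℝ) : ℂ) ^ (2 * q)‖ ≤ 3 ^ q * u ^ q := by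
        rw [norm_pow, Complex.norm_real, Real.norm_eq_abs, pow_mul, sq_abs]
        calc ((a ⬝ᵥ b) ^ 2) ^ q ≤ u ^ q :=
              pow_le_pow_left₀ (sq_nonneg _) (dotProduct_sq_le a b) q
          _ ≤ 3 ^ q * u ^ q :=
              le_mul_of_one_le_left (by positivity) (one_le_pow₀ (by norm_num))
      refine (norm_sub_le _ _).trans ?_
      split_ifs <;> first | linarith | tauto
    · rw [not_or] at hw
      have h1 : w + w' ≠ 0 := fun h => hw.1 (eq_neg_of_add_eq_zero_right h)
      have h2 : w - w' ≠ 0 := fun h => hw.2 (sub_eq_zero.mp h).symm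
      rw [factorMoment_eq_sq a b h1 h2, ← pow_mul]
      simp [hw.1, hw.2]
  refine (norm_sum_le _ _).trans ?_
  calc ∑ w : ZMod t, ‖∑ w' : ZMod t, (factorMoment a b w w' ^ q - ((a ⬝ᵥ b : ℝ) : ℂ) ^ (2 * q))‖
      ≤ ∑ w : ZMod t, (2 * (3 ^ q * u ^ q) + 2 * (3 ^ q * u ^ q)) := by
        refine Finset.sum_le_sum fun w _ => (norm_sum_le _ _).trans ?_
        refine (Finset.sum_le_sum fun w' _ => key w w').trans (le_of_eq ?_)
        rw [Finset.sum_add_distrib]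
        simp
    _ = 4 * t * (3 ^ q * u ^ q) := by
        rw [Finset.sum_const, Finset.card_univ, ZMod.card, nsmul_eq_mul]
        ring

/-- The inner product of two sketched polynomial features. -/
def sketchInner (a b : Fin d → ℝ) (h : Fin q → Fin d → ZMod t) (g : Fin q → Fin d → ℤˣ) : ℝ :=
  (polyFeature q a ᵥ* tensorSketch h g) ⬝ᵥ (polyFeature q b ᵥ* tensorSketch h g)

/-- The variance bound of TensorSketch for two polynomial features. -/
theorem IsTensorSketchHashing.integral_sketchInner_sub_sq_le (H : IsTensorSketchHashing P h g)
    (a b : Fin d → ℝ) :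
    ∫ ω, (sketchInner a b (fun c i => h c i ω) (fun c i => g c i ω) - (a ⬝ᵥ b) ^ q) ^ 2 ∂P
      ≤ 4 * (3 ^ q * ((a ⬝ᵥ a) ^ q * (b ⬝ᵥ b) ^ q)) / t := by
  have ht : (0 : ℝ) < t := Nat.cast_pos.mpr (NeZero.pos t)
  have ht' : (t : ℂ) ≠ 0 := Nat.cast_ne_zero.mpr (NeZero.ne t)
  have mX : Measurable fun ω =>
      ((fun c i => h c i ω : Fin q → Fin d → ZMod t), (fun c i => g c i ω : Fin q → Fin d → ℤˣ)) :=
    (measurable_pi_lambda _ fun c => measurable_pi_lambda _ fun i => H.measurable_h c i).prodMk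
      (measurable_pi_lambda _ fun c => measurable_pi_lambda _ fun i => H.measurable_g c i)
  have int : ∀ F : (Fin q → Fin d → ZMod t) × (Fin q → Fin d → ℤˣ) → ℂ,
      Integrable (fun ω => F (fun c i => h c i ω, fun c i => g c i ω)) P :=
    fun F => integrable_comp_of_finite mX F
  set T : Ω → ℝ := fun ω => sketchInner a b (fun c i => h c i ω) (fun c i => g c i ω)
  set m : ℝ := (a ⬝ᵥ b) ^ q with hm
  let Z : ZMod t → Ω → ℂ := fun w ω => ∏ c, (sketchChar a (fun i => h c i ω) (fun i => g c i ω) w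
      * sketchChar b (fun i => h c i ω) (fun i => g c i ω) (-w))
  have hT : ∀ ω, (T ω : ℂ) = (t : ℂ)⁻¹ * ∑ w, Z w ω := fun ω =>
    tensorSketch_inner_eq a b (fun c i => h c i ω) (fun c i => g c i ω)
  have hZ : ∀ w, ∫ ω, Z w ω ∂P = (m : ℂ) := fun w => by
    rw [hm, Complex.ofReal_pow]
    exact H.integral_prod_sketchChar a b w
  have iZ : ∀ w, Integrable (Z w) P := fun w => int fun x =>
    ∏ c, (sketchChar a (x.1 c) (x.2 c) w * sketchChar b (x.1 c) (x.2 c) (-w))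
  have iZZ : ∀ w w', Integrable (fun ω => Z w ω * Z w' ω) P := fun w w' => int fun x =>
    (∏ c, (sketchChar a (x.1 c) (x.2 c) w * sketchChar b (x.1 c) (x.2 c) (-w)))
      * ∏ c, (sketchChar a (x.1 c) (x.2 c) w' * sketchChar b (x.1 c) (x.2 c) (-w'))
  have hZZ : ∀ w w', ∫ ω, Z w ω * Z w' ω ∂P = factorMoment a b w w' ^ q := fun w w' =>
    H.integral_prod_sketchChar_mul a b w w'
  have iT : Integrable (fun ω => (T ω : ℂ)) P := int fun x => (sketchInner a b x.1 x.2 : ℂ)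
  have iT2 : Integrable (fun ω => (T ω : ℂ) ^ 2) P := int fun x => (sketchInner a b x.1 x.2 : ℂ) ^ 2
  have E1 : ∫ ω, (T ω : ℂ) ∂P = m := by
    simp only [hT]
    rw [integral_const_mul, integral_finsetSum _ fun w _ => iZ w]
    simp [hZ, ht']
  have E2 : ∫ ω, (T ω : ℂ) ^ 2 ∂P = (t : ℂ)⁻¹ ^ 2 * ∑ w : ZMod t, ∑ w' : ZMod t,
      factorMoment a b w w' ^ q := by
    simp only [hT, mul_pow]
    rw [integral_const_mul]
    congr 1
    simp only [sq, Finset.sum_mul_sum]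
    rw [integral_finsetSum _ fun w _ => integrable_finsetSum _ fun w' _ => iZZ w w']
    refine Finset.sum_congr rfl fun w _ => ?_
    rw [integral_finsetSum _ fun w' _ => iZZ w w']
    simp only [hZZ]
  -- The variance of the average of the Z_w is t⁻² times the sum of all their covariances.
  have E3 : ((∫ ω, (T ω - m) ^ 2 ∂P : ℝ) : ℂ) = (t : ℂ)⁻¹ ^ 2 *
      ∑ w : ZMod t, ∑ w' : ZMod t, (factorMoment a b w w' ^ q - ((a ⬝ᵥ b : ℝ) : ℂ) ^ (2 * q)) := by
    rw [← integral_complex_ofReal]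
    have : ∀ ω, (((T ω - m) ^ 2 : ℝ) : ℂ) = (T ω : ℂ) ^ 2 - 2 * m * T ω + m ^ 2 := fun ω => by
      push_cast
      ring
    simp only [this]
    have i1 : Integrable (fun ω => (T ω : ℂ) ^ 2 - 2 * m * T ω) P := iT2.sub (iT.const_mul _)
    rw [integral_add i1 (integrable_const _),
      integral_sub iT2 (iT.const_mul _), integral_const_mul, E1, E2]
    simp only [Finset.sum_sub_distrib, Finset.sum_const, Finset.card_univ, ZMod.card,
      nsmul_eq_mul, integral_const, probReal_univ, one_smul, hm, Complex.ofReal_pow]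
    field_simp
    ring
  have h0 : 0 ≤ ∫ ω, (T ω - m) ^ 2 ∂P := integral_nonneg fun ω => sq_nonneg _
  have h1 : ∫ ω, (T ω - m) ^ 2 ∂P = ‖((∫ ω, (T ω - m) ^ 2 ∂P : ℝ) : ℂ)‖ := by
    rw [Complex.norm_real, Real.norm_of_nonneg h0]
  rw [h1, E3, norm_mul, norm_pow, norm_inv, Complex.norm_natCast, ← mul_pow]
  refine (mul_le_mul_of_nonneg_left (norm_sum_factorMoment_sub_le (t := t) a b q)
    (by positivity)).trans (le_of_eq ?_)
  field_simp

end SketchVariance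

/-! ### The sketched kernel matrix -/

section SketchedKernel

variable {n d q t : ℕ}

theorem polyFeature_dotProduct (a b : Fin d → ℝ) :
    polyFeature q a ⬝ᵥ polyFeature q b = (a ⬝ᵥ b) ^ q := by
  simp only [dotProduct, polyFeature, ← Finset.prod_mul_distrib]
  have := Finset.prod_univ_sum (fun _ : Fin q => (Finset.univ : Finset (Fin d)))
    (fun _ i => a i * b i)
  rw [Fintype.piFinset_univ] at this
  rw [← this]
  simp

theorem featureMatrix_mul_transpose (A : Matrix (Fin n) (Fin d) ℝ) :
    featureMatrix A q * (featureMatrix A q)ᵀ = kernelMatrix A q := by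
  ext i j
  exact polyFeature_dotProduct (A i) (A j)

theorem kernelMatrix_posSemidef (A : Matrix (Fin n) (Fin d) ℝ) :
    (kernelMatrix A q).PosSemidef := by
  rw [← featureMatrix_mul_transpose, ← conjTranspose_eq_transpose_of_trivial]
  exact posSemidef_self_mul_conjTranspose _

variable [NeZero t]

/-- The squared Frobenius error of the sketched kernel matrix. -/
def sketchError (A : Matrix (Fin n) (Fin d) ℝ) (h : Fin q → Fin d → ZMod t)
    (g : Fin q → Fin d → ℤˣ) : ℝ :=
  frobSq (featureMatrix A q * tensorSketch h g * (featureMatrix A q * tensorSketch h g)ᵀ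
    - kernelMatrix A q)

theorem sketchError_nonneg (A : Matrix (Fin n) (Fin d) ℝ) (h : Fin q → Fin d → ZMod t)
    (g : Fin q → Fin d → ℤˣ) : 0 ≤ sketchError A h g :=
  frobSq_nonneg _

variable {Ω : Type*} [MeasurableSpace Ω] {P : Measure Ω} {h : Fin q → Fin d → Ω → ZMod t} {g : Fin q → Fin d → Ω → ℤˣ}

theorem IsTensorSketchHashing.measurable_prod (H : IsTensorSketchHashing P h g) :
    Measurable fun ω =>
      ((fun c i => h c i ω : Fin q → Fin d → ZMod t), (fun c i => g c i ω : Fin q → Fin d → ℤˣ)) :=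
  (measurable_pi_lambda _ fun c => measurable_pi_lambda _ fun i => H.measurable_h c i).prodMk
    (measurable_pi_lambda _ fun c => measurable_pi_lambda _ fun i => H.measurable_g c i)

variable [IsProbabilityMeasure P]

/-- Summing the entrywise variances makes the diagonal entries ‖a_i‖^{2q} of K appear as a product
of two sums, that is, as Tr(K)². -/
theorem IsTensorSketchHashing.integral_sketchError_le (H : IsTensorSketchHashing P h g)
    (A : Matrix (Fin n) (Fin d) ℝ) :
    ∫ ω, sketchError A (fun c i => h c i ω) (fun c i => g c i ω) ∂P
      ≤ 4 * (3 ^ q * (kernelMatrix A q).trace ^ 2) / t := by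
  have int : ∀ i j : Fin n, Integrable (fun ω =>
      (sketchInner (A i) (A j) (fun c i => h c i ω) (fun c i => g c i ω)
        - (A i ⬝ᵥ A j) ^ q) ^ 2) P := fun i j =>
    integrable_comp_of_finite H.measurable_prod fun x =>
      (sketchInner (A i) (A j) x.1 x.2 - (A i ⬝ᵥ A j) ^ q) ^ 2
  have e : ∀ ω, sketchError A (fun c i => h c i ω) (fun c i => g c i ω) = ∑ i, ∑ j,
      (sketchInner (A i) (A j) (fun c i => h c i ω) (fun c i => g c i ω)
        - (A i ⬝ᵥ A j) ^ q) ^ 2 := fun ω => rfl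
  simp only [e]
  rw [integral_finsetSum _ fun i _ => integrable_finsetSum _ fun j _ => int i j]
  calc _ ≤ ∑ i, ∑ j, 4 * (3 ^ q * ((A i ⬝ᵥ A i) ^ q * (A j ⬝ᵥ A j) ^ q)) / (t : ℝ) := by
        refine Finset.sum_le_sum fun i _ => ?_
        rw [integral_finsetSum _ fun j _ => int i j]
        exact Finset.sum_le_sum fun j _ => H.integral_sketchInner_sub_sq_le (A i) (A j)
    _ = _ := by
        have : (kernelMatrix A q).trace = ∑ i, (A i ⬝ᵥ A i) ^ q := rfl
        rw [this, sq (∑ i, _), Finset.sum_mul_sum]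
        simp only [Finset.mul_sum, Finset.sum_div]

/-- Markov's inequality for the nonnegative sketch error. -/
theorem IsTensorSketchHashing.measureReal_sketchError_lt (H : IsTensorSketchHashing P h g)
    (A : Matrix (Fin n) (Fin d) ℝ) {ε δ : ℝ} (hε : 0 < ε)
    (ht : 4 * (3 ^ q * (kernelMatrix A q).trace ^ 2) / t ≤ ε * δ) :
    1 - δ ≤ P.real {ω | sketchError A (fun c i => h c i ω) (fun c i => g c i ω) < ε} := by
  have hm : Measurable fun ω => sketchError A (fun c i => h c i ω) (fun c i => g c i ω) :=
    measurable_comp_of_finite H.measurable_prod fun x => sketchError A x.1 x.2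
  have hint : Integrable (fun ω => sketchError A (fun c i => h c i ω) (fun c i => g c i ω)) P :=
    integrable_comp_of_finite H.measurable_prod fun x => sketchError A x.1 x.2
  have h1 := mul_meas_ge_le_integral_of_nonneg
    (Filter.Eventually.of_forall fun ω => sketchError_nonneg A (fun c i => h c i ω) fun c i => g c i ω)
    hint ε
  have h2 := le_of_mul_le_mul_left (h1.trans ((H.integral_sketchError_le A).trans ht)) hε
  have h3 : {ω | sketchError A (fun c i => h c i ω) (fun c i => g c i ω) < ε}
      = {ω | ε ≤ sketchError A (fun c i => h c i ω) (fun c i => g c i ω)}ᶜ := by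
    ext ω
    simp
  rw [h3, probReal_compl_eq_one_sub (measurableSet_le measurable_const hm)]
  linarith

end SketchedKernel

/-! ### The leading eigenspace of the kernel matrix -/

section Eigenspace

variable {n d q : ℕ}

theorem kernelMatrix_spectral (A : Matrix (Fin n) (Fin d) ℝ) {k : ℕ} (hk : 1 ≤ k)
    (hgap : kernelEigenvalue A q (k + 1) < kernelEigenvalue A q k) :
    0 ≤ kernelEigenvalue A q (k + 1) ∧
    ∃ (W : Matrix (Fin n) (Fin n) ℝ) (lam : Fin n → ℝ) (s : Finset (Fin n)), Wᵀ * W = 1 ∧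
      kernelMatrix A q = W * diagonal lam * Wᵀ ∧ s.card = k ∧
      (∀ i ∈ s, kernelEigenvalue A q k ≤ lam i) ∧
      ∀ i ∉ s, lam i ≤ kernelEigenvalue A q (k + 1) := by
  set hH := kernelMatrix_isHermitian A q
  -- For k > n both eigenvalues take the default value 0, contradicting the strict gap.
  have hkn : k ≤ n := by
    by_contra! h
    simp [kernelEigenvalue, show ¬ k ≤ n by omega, show ¬ k + 1 ≤ n by omega] at hgap
  have hnn : ∀ j, 0 ≤ hH.eigenvalues₀ j := fun j => by
    have := (kernelMatrix_posSemidef (q := q) A).eigenvalues_nonneg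
      (Fintype.equivOfCardEq (Fintype.card_fin _) j)
    simpa [IsHermitian.eigenvalues] using this
  -- The eigenbasis is indexed by `Fin n` through an arbitrary equivalence, so s is the preimage of
  -- the first k positions of the sorted list.
  refine ⟨?_, hH.eigenvectorUnitary, hH.eigenvalues,
    Finset.univ.filter fun i =>
      ((Fintype.equivOfCardEq (Fintype.card_fin (Fintype.card (Fin n)))).symm i : ℕ) < k,
    ?_, ?_, ?_, ?_, ?_⟩
  · rw [kernelEigenvalue]
    split_ifs
    · exact hnn _
    · exact le_rfl
  · have := Unitary.coe_star_mul_self hH.eigenvectorUnitary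
    simpa [star_eq_conjTranspose, conjTranspose_eq_transpose_of_trivial] using this
  · refine hH.spectral_theorem.trans ?_
    simp [Unitary.conjStarAlgAut_apply, star_eq_conjTranspose,
      conjTranspose_eq_transpose_of_trivial]
  · rw [← Finset.card_map (Fintype.equivOfCardEq
      (Fintype.card_fin (Fintype.card (Fin n)))).symm.toEmbedding]
    have : (Finset.univ.filter fun i : Fin n =>
        ((Fintype.equivOfCardEq (Fintype.card_fin (Fintype.card (Fin n)))).symm i : ℕ) < k).map
        (Fintype.equivOfCardEq (Fintype.card_fin (Fintype.card (Fin n)))).symm.toEmbedding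
        = Finset.univ.filter fun i : Fin (Fintype.card (Fin n)) => (i : ℕ) < k := by
      ext j
      simp [Finset.mem_map_equiv]
    rw [this, card_filter_fin_lt, Fintype.card_fin, min_eq_left hkn]
  · intro i hi
    rw [kernelEigenvalue, dif_pos ⟨hk, hkn⟩]
    refine hH.eigenvalues₀_antitone ?_
    simp only [Finset.mem_filter, Finset.mem_univ, true_and] at hi
    exact Fin.le_def.mpr (Nat.le_sub_one_of_lt hi)
  · intro i hi
    simp only [Finset.mem_filter, Finset.mem_univ, true_and, not_lt] at hi
    -- An index outside s has sorted position at least k, which forces k < n, so λ_{k+1} is a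
    -- genuine eigenvalue here.
    have hlt := ((Fintype.equivOfCardEq (Fintype.card_fin (Fintype.card (Fin n)))).symm i).2
    have hkn' : k + 1 ≤ n := by
      have := Fintype.card_fin n
      omega
    rw [kernelEigenvalue, dif_pos ⟨by omega, hkn'⟩]
    exact hH.eigenvalues₀_antitone (Fin.le_def.mpr hi)

end Eigenspace

/-! ### Risk of projection estimators -/

section Risk

variable {m p : Type*} [Fintype m] [Fintype p]

theorem euclNorm_sq (v : m → ℝ) : euclNorm v ^ 2 = v ⬝ᵥ v := by
  rw [euclNorm, EuclideanSpace.norm_sq_eq]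
  simp [dotProduct, sq]

theorem euclNorm_nonneg (v : m → ℝ) : 0 ≤ euclNorm v := norm_nonneg _

theorem euclNorm_add_le (v w : m → ℝ) : euclNorm (v + w) ≤ euclNorm v + euclNorm w := by
  rw [euclNorm, WithLp.toLp_add]
  exact norm_add_le _ _

theorem IsOrthProj.euclNorm_mulVec_le {Q : Matrix m m ℝ} (hQ : IsOrthProj Q) (v : m → ℝ) :
    euclNorm (Q *ᵥ v) ≤ euclNorm v := by
  refine le_of_sq_le_sq ?_ (euclNorm_nonneg _)
  rw [euclNorm_sq, euclNorm_sq]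
  have h1 : (Q *ᵥ v) ⬝ᵥ (Q *ᵥ v) = v ⬝ᵥ (Q *ᵥ v) := by
    rw [dotProduct_mulVec, ← mulVec_transpose, hQ.symm, mulVec_mulVec, hQ.idem, dotProduct_comm]
  have h2 : 0 ≤ (v - Q *ᵥ v) ⬝ᵥ (v - Q *ᵥ v) :=
    Finset.sum_nonneg fun _ _ => mul_self_nonneg _
  rw [sub_dotProduct, dotProduct_sub, dotProduct_sub, h1, dotProduct_comm (Q *ᵥ v) v] at h2
  linarith

/-- Least squares minimizers have the fitted values `M M⁺ b`. -/
theorem mulVec_eq_of_forall_euclNorm_le (M : Matrix m p ℝ) (b : m → ℝ) (x : p → ℝ)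
    (hx : ∀ y, euclNorm (M *ᵥ x - b) ≤ euclNorm (M *ᵥ y - b)) :
    M *ᵥ x = (M * pinv M) *ᵥ b := by
  have h := hx (pinv M *ᵥ b)
  rw [mulVec_mulVec] at h
  set z := M *ᵥ x - (M * pinv M) *ᵥ b with hz
  have hQ := isOrthProj_mul_pinv M
  have hMQ : Mᵀ * (M * pinv M) = Mᵀ := by
    rw [← hQ.symm, ← transpose_mul, (pinv_spec M).mul_left]
  have hzM : z = M *ᵥ (x - pinv M *ᵥ b) := by rw [mulVec_sub, mulVec_mulVec]
  -- The residual of M M⁺ b is orthogonal to the range of M; by Pythagoras, a minimizer cannot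
  -- differ from it by a nonzero z in that range.
  have horth : z ⬝ᵥ ((M * pinv M) *ᵥ b - b) = 0 := by
    rw [hzM, dotProduct_comm, dotProduct_mulVec, ← mulVec_transpose, mulVec_sub, mulVec_mulVec,
      hMQ, sub_self, zero_dotProduct]
  have e : M *ᵥ x - b = z + ((M * pinv M) *ᵥ b - b) := by rw [hz]; abel
  have h2 := pow_le_pow_left₀ (euclNorm_nonneg _) h 2
  rw [e, euclNorm_sq, euclNorm_sq, add_dotProduct, dotProduct_add, dotProduct_add, horth,
    dotProduct_comm ((M * pinv M) *ᵥ b - b) z, horth] at h2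
  have h3 : z ⬝ᵥ z ≤ 0 := by linarith
  have h4 : z = 0 := dotProduct_self_eq_zero.mp
    (le_antisymm h3 (Finset.sum_nonneg fun _ _ => mul_self_nonneg _))
  exact sub_eq_zero.mp h4

variable {n : ℕ} {Ω' : Type*} [MeasurableSpace Ω'] {μ : Measure Ω'} [IsProbabilityMeasure μ]
  {f : Fin n → ℝ} {σ : ℝ} {ξ : Fin n → Ω' → ℝ} {b : Ω' → Fin n → ℝ}

namespace IsFixedDesignResponse

/-- Centering removes the cross term, and independence makes the variances of the summands add. -/
theorem integral_add_linear_sq (hb : IsFixedDesignResponse μ f σ ξ b) (v : ℝ) (c : Fin n → ℝ) :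
    Integrable (fun ω => (v + ∑ j, c j * ξ j ω) ^ 2) μ ∧
    ∫ ω, (v + ∑ j, c j * ξ j ω) ^ 2 ∂μ = v ^ 2 + σ ^ 2 * ∑ j, c j ^ 2 := by
  have hL : ∀ j, MemLp (fun ω => c j * ξ j ω) 2 μ := fun j => (hb.memLp j).const_mul _
  have hS : MemLp (∑ j, fun ω => c j * ξ j ω) 2 μ := memLp_finsetSum' _ fun j _ => hL j
  have hSe : (∑ j, fun ω => c j * ξ j ω) = fun ω => ∑ j, c j * ξ j ω := by
    ext ω
    simp
  have hmean : ∫ ω, ∑ j, c j * ξ j ω ∂μ = 0 := by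
    rw [integral_finsetSum _ fun j _ => (hL j).integrable one_le_two]
    refine Finset.sum_eq_zero fun j _ => ?_
    rw [integral_const_mul, hb.mean, mul_zero]
  have hvar := IndepFun.variance_sum (X := fun j ω => c j * ξ j ω) (s := Finset.univ) (μ := μ)
    (fun j _ => hL j) (fun i _ j _ hij => (hb.indep.indepFun hij).comp
      (measurable_const_mul (c i)) (measurable_const_mul (c j)))
  rw [variance_eq_sub hS, hSe, hmean] at hvar
  simp only [variance_const_mul, hb.variance, Pi.pow_apply] at hvar
  rw [hSe] at hS
  have i1 := hS.integrable one_le_two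
  have i2 := hS.integrable_sq
  have e : ∀ ω, (v + ∑ j, c j * ξ j ω) ^ 2
      = v ^ 2 + 2 * v * ∑ j, c j * ξ j ω + (∑ j, c j * ξ j ω) ^ 2 := fun ω => by ring
  simp only [e]
  have i3 : Integrable (fun ω => v ^ 2 + 2 * v * ∑ j, c j * ξ j ω) μ :=
    (integrable_const _).add (i1.const_mul _)
  refine ⟨i3.add i2, ?_⟩
  rw [integral_add i3 i2, integral_add (integrable_const _) (i1.const_mul _), integral_const_mul,
    hmean]
  simp only [integral_const, probReal_univ, one_smul]
  rw [Finset.mul_sum]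
  simp only [mul_comm (σ ^ 2)]
  linarith

/-- The bias–variance decomposition, obtained row by row; the noise contributes σ² times the squared
Frobenius norm of B. -/
theorem integral_euclNorm_sq (hb : IsFixedDesignResponse μ f σ ξ b) (B : Matrix m (Fin n) ℝ)
    (y : m → ℝ) :
    ∫ ω, euclNorm (B *ᵥ b ω - y) ^ 2 ∂μ = euclNorm (B *ᵥ f - y) ^ 2 + σ ^ 2 * frobSq B := by
  have e : ∀ ω, euclNorm (B *ᵥ b ω - y) ^ 2
      = ∑ i, ((B *ᵥ f - y) i + ∑ j, B i j * ξ j ω) ^ 2 := fun ω => by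
    rw [euclNorm_sq, dotProduct]
    refine Finset.sum_congr rfl fun i _ => ?_
    rw [sq]
    have : (B *ᵥ b ω - y) i = (B *ᵥ f - y) i + ∑ j, B i j * ξ j ω := by
      simp only [Pi.sub_apply, mulVec, dotProduct, hb.response, mul_add, Finset.sum_add_distrib]
      ring
    rw [this]
  have hi := fun i => hb.integral_add_linear_sq ((B *ᵥ f - y) i) fun j => B i j
  simp only [e]
  rw [integral_finsetSum _ fun i _ => (hi i).1]
  simp only [fun i => (hi i).2, Finset.sum_add_distrib, ← Finset.mul_sum]
  rw [euclNorm_sq, frobSq]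
  simp [dotProduct, sq]

/-- The fitted values of the optimal predictor are the projection of `f`. -/
theorem mulVec_optimalPredictor (hb : IsFixedDesignResponse μ f σ ξ b) (hn : 0 < n)
    {X : Matrix (Fin n) p ℝ} {xstar : p → ℝ} (hx : IsOptimalPredictor μ X b xstar) :
    X *ᵥ xstar = (X * pinv X) *ᵥ f := by
  have hn' : (0 : ℝ) < n := Nat.cast_pos.mpr hn
  have e : ∀ y : p → ℝ, ∫ ω, euclNorm (X *ᵥ y - b ω) ^ 2 / n ∂μ
      = (euclNorm (X *ᵥ y - f) ^ 2 + σ ^ 2 * frobSq (-1 : Matrix (Fin n) (Fin n) ℝ)) / n := by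
    intro y
    -- Writing Xy − b as (−1)b − (−Xy) fits the bias–variance formula; the noise term is then
    -- independent of y, leaving ordinary least squares for f.
    have h := hb.integral_euclNorm_sq (-1) (-(X *ᵥ y))
    simp only [neg_mulVec, one_mulVec, sub_neg_eq_add, neg_add_eq_sub] at h
    rw [integral_div, h]
  refine mulVec_eq_of_forall_euclNorm_le X f xstar fun y => ?_
  have h := hx.1 y
  rw [e, e, div_le_div_iff_of_pos_right hn', add_le_add_iff_right] at h
  exact le_of_sq_le_sq h (euclNorm_nonneg _)

theorem excessRisk_eq (hb : IsFixedDesignResponse μ f σ ξ b) (X : Matrix (Fin n) p ℝ)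
    (xstar : p → ℝ) {θ : Ω' → p → ℝ} {Q : Matrix (Fin n) (Fin n) ℝ}
    (hθ : ∀ ω, X *ᵥ θ ω = Q *ᵥ b ω) :
    excessRisk μ X xstar θ
      = (euclNorm (Q *ᵥ f - X *ᵥ xstar) ^ 2 + σ ^ 2 * frobSq Q) / n := by
  simp only [excessRisk, hθ]
  rw [integral_div, hb.integral_euclNorm_sq]

end IsFixedDesignResponse

/-- In coordinates c with x = V_k c, the constrained problem is unconstrained least squares for
XV_k. -/
theorem IsPCRSolution.mulVec_eq {X : Matrix m p ℝ} {S : ThinSVD X} {k : ℕ} {b : m → ℝ}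
    {x : p → ℝ} (hx : IsPCRSolution S k b x) : X *ᵥ x = S.proj k *ᵥ b := by
  obtain ⟨⟨c, rfl⟩, hmin⟩ := hx
  have := mulVec_eq_of_forall_euclNorm_le (X * S.leadingV k) b c fun y => by
    simpa only [mulVec_mulVec] using hmin _ ⟨y, rfl⟩
  simp only [mulVec_mulVec]
  exact this

theorem mulVec_sketchedPCR {r : Type*} [Fintype r] (X : Matrix m p ℝ) (R : Matrix p r ℝ)
    (T : ThinSVD (X * R)) (k : ℕ) (b : m → ℝ) :
    X *ᵥ sketchedPCR X R T k b = T.proj k *ᵥ b := by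
  rw [sketchedPCR, mulVec_mulVec, ThinSVD.proj]
  simp only [Matrix.mul_assoc]

/-- Comparison of the risks of two projection estimators. -/
theorem projection_risk_le {Q₁ Q₂ : Matrix m m ℝ} (h₁ : IsOrthProj Q₁) (h₂ : IsOrthProj Q₂)
    {E : Matrix m m ℝ} (hE : IsOrthProj E) (hEQ : E * Q₁ = Q₁) (htr : Q₂.trace ≤ Q₁.trace)
    {ν : ℝ} (hν : 0 ≤ ν) (hclose : frobSq (Q₁ - Q₂) ≤ ν ^ 2) (f : m → ℝ) (σ : ℝ) :
    euclNorm (Q₂ *ᵥ f - E *ᵥ f) ^ 2 + σ ^ 2 * frobSq Q₂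
      ≤ euclNorm (Q₁ *ᵥ f - E *ᵥ f) ^ 2 + σ ^ 2 * frobSq Q₁ + (2 * ν + ν ^ 2) * euclNorm f ^ 2 := by
  have hQE : Q₁ * E = Q₁ := by
    rw [← h₁.symm, ← hE.symm, ← transpose_mul, hEQ]
  -- The range of Q₁ lies in that of E, so the exact bias is, up to sign, a projection of f and has
  -- norm at most ‖f‖.
  have hD : IsOrthProj (E - Q₁) := by
    refine ⟨by rw [transpose_sub, hE.symm, h₁.symm], ?_⟩
    rw [Matrix.sub_mul, Matrix.mul_sub, Matrix.mul_sub, hE.idem, h₁.idem, hEQ, hQE]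
    simp
  have h1 : euclNorm (Q₁ *ᵥ f - E *ᵥ f) ≤ euclNorm f := by
    have := hD.euclNorm_mulVec_le f
    rw [sub_mulVec] at this
    rwa [← neg_sub, euclNorm, WithLp.toLp_neg, norm_neg]
  have h2 : euclNorm (Q₂ *ᵥ f - Q₁ *ᵥ f) ≤ ν * euclNorm f := by
    refine le_of_sq_le_sq ?_ (mul_nonneg hν (euclNorm_nonneg _))
    rw [mul_pow, euclNorm_sq, euclNorm_sq, ← sub_mulVec]
    refine (mulVec_dotProduct_self_le _ f).trans (mul_le_mul_of_nonneg_right ?_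
      (Finset.sum_nonneg fun _ _ => mul_self_nonneg _))
    rwa [← neg_sub, frobSq_neg]
  have h3 : euclNorm (Q₂ *ᵥ f - E *ᵥ f) ≤ euclNorm (Q₁ *ᵥ f - E *ᵥ f) + ν * euclNorm f := by
    have := euclNorm_add_le (Q₁ *ᵥ f - E *ᵥ f) (Q₂ *ᵥ f - Q₁ *ᵥ f)
    rw [show Q₁ *ᵥ f - E *ᵥ f + (Q₂ *ᵥ f - Q₁ *ᵥ f) = Q₂ *ᵥ f - E *ᵥ f by abel] at this
    linarith
  have h4 := pow_le_pow_left₀ (euclNorm_nonneg _) h3 2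
  -- The squared Frobenius norm of a projection is its trace, so the variances compare by rank.
  have h5 : σ ^ 2 * frobSq Q₂ ≤ σ ^ 2 * frobSq Q₁ := by
    rw [h₁.frobSq_eq, h₂.frobSq_eq]
    exact mul_le_mul_of_nonneg_left htr (sq_nonneg _)
  have h6 : euclNorm (Q₁ *ᵥ f - E *ᵥ f) * (ν * euclNorm f) ≤ euclNorm f * (ν * euclNorm f) :=
    mul_le_mul_of_nonneg_right h1 (mul_nonneg hν (euclNorm_nonneg _))
  nlinarith [h4, h5, h6]

end Risk

/-! ### The risk bound for sketched kernel PCR -/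

theorem mainTheorem9 :
    ∃ C : ℝ, 0 < C ∧
      ∀ (n d q k t : ℕ) [NeZero t] (A : Matrix (Fin n) (Fin d) ℝ) (ν δ : ℝ),
        0 < ν → ν < 1 / 2 → 0 < δ → δ < 1 / 2 →
        -- the rank parameter, with the eigengap `λ_k > λ_{k+1}`
        1 ≤ k → kernelEigenvalue A q (k + 1) < kernelEigenvalue A q k →
        -- the number of columns of the sketch
        C * (3 ^ q * (kernelMatrix A q).trace ^ 2 /
          ((kernelEigenvalue A q k - kernelEigenvalue A q (k + 1)) ^ 2 * ν ^ 2 * δ)) ≤ (t : ℝ) →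
        -- the random functions that define the TensorSketch matrix
        ∀ (Ω : Type*) [MeasurableSpace Ω] (P : Measure Ω) [IsProbabilityMeasure P]
          (h : Fin q → Fin d → Ω → ZMod t) (g : Fin q → Fin d → Ω → ℤˣ),
        IsTensorSketchHashing P h g →
        -- the responses
        ∀ (Ω' : Type*) [MeasurableSpace Ω'] (μ : Measure Ω') [IsProbabilityMeasure μ]
          (f : Fin n → ℝ) (σ : ℝ) (ξ : Fin n → Ω' → ℝ) (b : Ω' → Fin n → ℝ),
        IsFixedDesignResponse μ f σ ξ b →
        ∀ xstar : (Fin q → Fin d) → ℝ, IsOptimalPredictor μ (featureMatrix A q) b xstar →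
        -- the exact kernel PCR estimator
        ∀ (S : ThinSVD (featureMatrix A q)) (xK : Ω' → (Fin q → Fin d) → ℝ),
        (∀ ω', IsPCRSolution S k (b ω') (xK ω')) →
        1 - δ ≤ P.real {ω |
          ∀ T : ThinSVD (featureMatrix A q *
              tensorSketch (fun c i => h c i ω) (fun c i => g c i ω)),
            excessRisk μ (featureMatrix A q) xstar
                (fun ω' => sketchedPCR (featureMatrix A q)
                  (tensorSketch (fun c i => h c i ω) (fun c i => g c i ω)) T k (b ω'))
              ≤ excessRisk μ (featureMatrix A q) xstar xK
                + (2 * ν + ν ^ 2) * euclNorm f ^ 2 / n} := by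
  -- 16 = 4 · 4: one factor from the sketch variance, the other from the squared perturbation bound.
  refine ⟨16, by norm_num, ?_⟩
  intro n d q k t _ A ν δ hν _ hδ _ hk hgap ht Ω _ P _ h g H Ω' _ μ _ f σ ξ b hb xstar hx S xK hxK
  obtain ⟨hβ, W, lam, s, hW, hK, hs, hα, hβ'⟩ := kernelMatrix_spectral A hk hgap
  have hΔ : 0 < kernelEigenvalue A q k - kernelEigenvalue A q (k + 1) := sub_pos.mpr hgap
  set Δ := kernelEigenvalue A q k - kernelEigenvalue A q (k + 1) with hΔdef
  have ht0 : (0 : ℝ) < t := Nat.cast_pos.mpr (NeZero.pos t)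
  set PK := W * diagonal (fun i => if i ∈ s then (1 : ℝ) else 0) * Wᵀ with hPK
  have hn : 0 < n := by
    have := Finset.card_le_univ s
    rw [hs, Fintype.card_fin] at this
    omega
  have hPKproj : IsOrthProj PK := isOrthProj_conj_indicator hW s
  have hPKtr : PK.trace = k := by
    rw [hPK, trace_mul_comm, ← Matrix.mul_assoc, hW, Matrix.one_mul, trace_diagonal]
    simp [hs]
  -- Stated for a general Y so that it applies both to Y = Φ and to Y = ΦR.
  have hproj : ∀ {r : Type} [Fintype r] {Y : Matrix (Fin n) r ℝ} (T : ThinSVD Y),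
      frobSq (PK - T.proj k) ≤ 4 * frobSq (Y * Yᵀ - kernelMatrix A q) / Δ ^ 2 := fun {r} _ {Y} T =>
    frobSq_spectralProj_sub_le hW lam s hβ hgap hα hβ' hK hPK (T.isOrthProj_proj k)
      (by rw [hs]; exact T.trace_proj_le k)
      (T.trace_mul_le_trace_mul_proj k hPKproj hPKtr.le)
  -- For Y = Φ the perturbation is zero, so the PCR projection is the spectral projection of K for
  -- every choice of decomposition of Φ.
  have hS : PK = S.proj k := by
    have h0 := hproj S
    rw [featureMatrix_mul_transpose, sub_self] at h0
    exact sub_eq_zero.mp (frobSq_eq_zero (h0.trans (by simp [frobSq])))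
  have hε : 0 < ν ^ 2 * Δ ^ 2 / 4 := by positivity
  have hprob := H.measureReal_sketchError_lt A (δ := δ) hε (by
    rw [mul_div_assoc', div_le_iff₀ (by positivity)] at ht
    rw [div_le_iff₀ ht0]
    linarith)
  -- The good event depends on R alone, so one event serves all decompositions T at once;
  -- monotonicity requires no measurability of the target set.
  refine hprob.trans (measureReal_mono ?_)
  intro ω hω T
  have hω' : sketchError A (fun c i => h c i ω) (fun c i => g c i ω) < ν ^ 2 * Δ ^ 2 / 4 := hω
  have hclose : frobSq (S.proj k - T.proj k) ≤ ν ^ 2 := by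
    rw [← hS]
    refine (hproj T).trans ?_
    rw [div_le_iff₀ (by positivity)]
    change 4 * sketchError A (fun c i => h c i ω) (fun c i => g c i ω) ≤ _
    linarith
  rw [hb.excessRisk_eq _ _ fun ω' => mulVec_sketchedPCR (featureMatrix A q) _ T k (b ω'),
    hb.excessRisk_eq _ _ fun ω' => (hxK ω').mulVec_eq, hb.mulVec_optimalPredictor hn hx, ← add_div]
  refine div_le_div_of_nonneg_right ?_ (Nat.cast_nonneg n)
  refine projection_risk_le (S.isOrthProj_proj k) (T.isOrthProj_proj k) (isOrthProj_mul_pinv _) ?_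
    ?_ hν.le hclose f σ
  · rw [ThinSVD.proj, Matrix.mul_assoc (featureMatrix A q) (S.leadingV k), ← Matrix.mul_assoc,
      (pinv_spec _).mul_left]
  · rw [← hS, hPKtr]
    exact T.trace_proj_le k
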